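/- Let $G$ be a (finite-dimensional, real, smooth) Lie group with identity element $1$ and Lie algebra $\mathfrak g=T_1G$, let $V\subseteq\mathfrak g$ be a linear subspace that generates $\mathfrak g$ as a Lie algebra, and let $\|\cdot\|$ be a norm on $V$ with energy $\mathrm E(v)=\tfrac12\|v\|^2$. Assume that $\|\cdot\|$ is strongly convex, i.e. there is a Euclidean norm $N$ on $V$ (a norm induced by a scalar product) with $$\mathrm E(tv+(1-t)u)\le t\,\mathrm E(v)+(1-t)\,\mathrm E(u)-t(1-t)N(u-v)^2\qquad\text{for all }u,v\in V,\ t\in[0,1].$$ For $\lambda\in\mathfrak g^*$, a normal curve on $[0,1]$ with associated covector $\lambda$ is an absolutely continuous curve $\gamma:[0,1]\to G$ for which there is a control $u\in L^2([0,1],V)$ such that, for almost every $t\in[0,1]$, $$\dot\gamma(t)=\mathrm dL_{\gamma(t)}u(t)\qquad\text{and}\qquad \lambda\circ\mathrm{Ad}_{\gamma(t)}|_V\in\partial_{u(t)}\mathrm E,$$ where $L_g$ is the left translation by $g$, $\mathrm{Ad}_g$ is the differential at $1$ of $x\mapsto gxg^{-1}$, and $\partial_u\mathrm E=\{\eta\in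 V^*:\eta(v-u)\le \mathrm E(v)-\mathrm E(u)\ \text{for all } v\in V\}$. Then for every $p\in G$ and every $\lambda\in\mathfrak g^*$ there exists a unique normal curve $\gamma:[0,1]\to G$ with associated covector $\lambda$ and $\gamma(0)=p$. Moreover, $\gamma$ is of class $C^{1,1}$ on $[0,1]$, i.e. it is $C^1$ and its derivative is Lipschitz in charts. -/

import Mathlib

open Set MeasureTheory
open scoped Manifold ContDiff NNReal

noncomputable section

/-! ### Convex analysis -/

/-- The subdifferential of `f : V → ℝ` at `u`. It is used for finite-dimensional `V` only, where
every linear functional is continuous. -/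
def subdifferential {V : Type*} [AddCommGroup V] [Module ℝ V] (f : V → ℝ) (u : V) :
    Set (Module.Dual ℝ V) :=
  {η | ∀ v : V, η (v - u) ≤ f v - f u}

/-- Strong convexity of a function. The square of a Euclidean norm (a norm that comes from a scalar
product) is the same thing as a positive definite quadratic form `Q`. -/
def IsStronglyConvexFun {V : Type*} [AddCommGroup V] [Module ℝ V] (f : V → ℝ) : Prop :=
  ∃ Q : QuadraticForm ℝ V, Q.PosDef ∧
    ∀ u v : V, ∀ t ∈ Icc (0 : ℝ) 1,
      f (t • v + (1 - t) • u) ≤ t * f v + (1 - t) * f u - t * (1 - t) * Q (u - v)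

/-! ### Curves in manifolds -/

section Curves

variable {E : Type*} [NormedAddCommGroup E] [NormedSpace ℝ E]
  {M : Type*} [TopologicalSpace M] [ChartedSpace E M]

/-- `γ` is absolutely continuous on `[a, b]`: it is continuous there, and its expression in any
chart is absolutely continuous on each compact subinterval that `γ` maps into the chart domain. -/
def IsACCurve (E : Type*) [NormedAddCommGroup E] [NormedSpace ℝ E]
    {M : Type*} [TopologicalSpace M] [ChartedSpace E M] (γ : ℝ → M) (a b : ℝ) : Prop :=
  ContinuousOn γ (Icc a b) ∧
    ∀ e ∈ atlas E M, ∀ c d : ℝ, c ≤ d → Icc c d ⊆ Icc a b → MapsTo γ (Icc c d) e.source →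
      AbsolutelyContinuousOnInterval (fun t => e (γ t)) c d

/-- `γ` is of class `C^{1,1}` on `[a, b]`: it is `C^1`, and the derivative of its expression in any
chart is Lipschitz on each compact subinterval that `γ` maps into the chart domain. -/
def IsC11Curve (E : Type*) [NormedAddCommGroup E] [NormedSpace ℝ E]
    {M : Type*} [TopologicalSpace M] [ChartedSpace E M] (γ : ℝ → M) (a b : ℝ) : Prop :=
  ContMDiffOn 𝓘(ℝ, ℝ) 𝓘(ℝ, E) 1 γ (Icc a b) ∧
    ∀ e ∈ atlas E M, ∀ c d : ℝ, c ≤ d → Icc c d ⊆ Icc a b → MapsTo γ (Icc c d) e.source →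
      ∃ K : ℝ≥0, LipschitzOnWith K (derivWithin (fun t => e (γ t)) (Icc c d)) (Icc c d)

end Curves

/-! ### Sub-Finsler Lie groups -/

/-- A smooth Lie group is regular enough for Mathlib's Lie bracket on its tangent space at `1`. -/
instance instLEInftyMinSmoothnessReal : ENat.LEInfty (minSmoothness ℝ 3) :=
  ⟨by simp only [minSmoothness_of_isRCLikeNormedField]; exact ENat.LEInfty.out⟩

section LieGroup

variable (E : Type*) [NormedAddCommGroup E] [NormedSpace ℝ E] [FiniteDimensional ℝ E]
  (G : Type*) [TopologicalSpace G] [ChartedSpace E G] [Group G] [LieGroup 𝓘(ℝ, E) ∞ G]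

/-- The adjoint map `Ad_g`, the differential at `1` of the conjugation `x ↦ g x g⁻¹`. -/
def lieAd {G : Type*} [TopologicalSpace G] [ChartedSpace E G] [Group G] (g : G) :
    GroupLieAlgebra 𝓘(ℝ, E) G →L[ℝ] GroupLieAlgebra 𝓘(ℝ, E) G :=
  mfderiv 𝓘(ℝ, E) 𝓘(ℝ, E) (fun x : G => g * x * g⁻¹) 1

/-- A sub-Finsler structure on the Lie group `G`: a linear subspace `V` of the Lie algebra which
generates it as a Lie algebra, and a norm on `V`. -/
structure SubFinslerStructure where
  /-- the polarization -/
  V : Submodule ℝ (GroupLieAlgebra 𝓘(ℝ, E) G)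
  bracketGenerating :
    LieSubalgebra.lieSpan ℝ (GroupLieAlgebra 𝓘(ℝ, E) G)
      (V : Set (GroupLieAlgebra 𝓘(ℝ, E) G)) = ⊤
  /-- the norm; with the next field, this seminorm is a norm -/
  nrm : Seminorm ℝ V
  eq_zero_of_nrm_eq_zero : ∀ v : V, nrm v = 0 → v = 0

namespace SubFinslerStructure

variable {E G}
variable (S : SubFinslerStructure E G)

/-- The energy `v ↦ ‖v‖² / 2` of the norm. -/
def energy (v : S.V) : ℝ := (1 / 2) * S.nrm v ^ 2

/-- The norm is strongly convex if its energy is a strongly convex function. -/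
def IsStronglyConvex : Prop := IsStronglyConvexFun S.energy

/-- `γ` is a horizontal curve on `[a, b]` with control `u`: it is absolutely continuous, and for
almost every `t` it is differentiable at `t`, with velocity `dL_{γ(t)} u(t)`, where `u(t) ∈ V`. -/
def IsHorizontalCurve (γ : ℝ → G) (a b : ℝ) (u : ℝ → S.V) : Prop :=
  IsACCurve E γ a b ∧
    ∀ᵐ t ∂(volume.restrict (Icc a b)),
      HasMFDerivWithinAt 𝓘(ℝ, ℝ) 𝓘(ℝ, E) γ (Icc a b) t
        ((1 : ℝ →L[ℝ] ℝ).smulRight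
          (mulInvariantVectorField (u t : GroupLieAlgebra 𝓘(ℝ, E) G) (γ t)))

/-- The restriction to `V` of the covector `lam ∘ Ad_g`. -/
def adRestrict (lam : Module.Dual ℝ (GroupLieAlgebra 𝓘(ℝ, E) G)) (g : G) : Module.Dual ℝ S.V :=
  (lam ∘ₗ (lieAd E g).toLinearMap) ∘ₗ S.V.subtype

/-- `γ` is a normal curve on `[a, b]` with associated covector `lam`: it is horizontal with a
control `u ∈ L²([a, b], V)`, and `lam ∘ Ad_{γ(t)}|_V` is a subgradient of the energy at `u(t)` for
almost every `t`. -/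
def IsNormalCurve (γ : ℝ → G) (a b : ℝ)
    (lam : Module.Dual ℝ (GroupLieAlgebra 𝓘(ℝ, E) G)) : Prop :=
  ∃ u : ℝ → S.V,
    S.IsHorizontalCurve γ a b u ∧
    AEStronglyMeasurable u (volume.restrict (Icc a b)) ∧
    MemLp (fun t => S.nrm (u t)) 2 (volume.restrict (Icc a b)) ∧
    ∀ᵐ t ∂(volume.restrict (Icc a b)),
      S.adRestrict lam (γ t) ∈ subdifferential S.energy (u t)

end SubFinslerStructure

end LieGroup

end

noncomputable section

open Filter Topology Metric

/-! ### Subgradients of strongly convex energies -/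

section Convex

variable {V : Type*} [NormedAddCommGroup V] [NormedSpace ℝ V] [FiniteDimensional ℝ V]

/-! By strong convexity, every covector `μ` restricts to a subgradient of the energy at exactly one
vector `P μ` of the polarization, and `P` is Lipschitz (`exists_isEnergyGradient`). The inclusion in
the definition of a normal curve therefore determines the control, and normal curves are the
solutions of the autonomous equation `γ' = dL_γ P(μ ∘ Ad_γ)`, whose right-hand side is locally
Lipschitz in charts. An absolutely continuous curve that solves it almost everywhere solves it
everywhere, because the right-hand side is continuous along the curve. Uniqueness and `C^{1,1}`
regularity follow from the Lipschitz bound.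

Global existence rests on conservation of the dual energy `H μ`, which is the energy of `P μ`. The
derivative of `Ad_γ` along a velocity `dL_γ u` kills `u`, as `[u, u] = 0`, so `μ ∘ Ad_γ` varies in
directions that annihilate the gradient of `H`. Bounded dual energy bounds `P`, hence the speed.
Since `H` sees only the restriction of `μ` to the polarization, the covectors themselves, and the
Lipschitz constants of the equation, need not stay bounded. The Picard-Lindelöf existence time,
however, depends only on a speed bound in a fixed chart ball at `1`. Truncating the control provides
this bound, and since the truncated flow also conserves `H`, the truncation never acts. Left
translation carries the argument to any starting point with the same time step, so finitely many
steps cover the interval. -/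

theorem QuadraticMap.PosDef.exists_mul_sq_norm_le {Q : QuadraticForm ℝ V} (hQ : Q.PosDef) :
    ∃ a : ℝ, 0 < a ∧ ∀ v, a * ‖v‖ ^ 2 ≤ Q v := by
  have hc : Continuous Q := by
    have h : (Q : V → ℝ) = fun v => (LinearMap.toContinuousLinearMap
        ((LinearMap.toContinuousLinearMap : (V →ₗ[ℝ] ℝ) ≃ₗ[ℝ] _).toLinearMap ∘ₗ
          QuadraticMap.associated Q)) v v := by
      ext v
      simp [QuadraticMap.associated_eq_self_apply]
    rw [h]
    fun_prop
  -- The trivial space has an empty unit sphere, so there is nothing to minimize over.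
  rcases subsingleton_or_nontrivial V with hV | hV
  · exact ⟨1, one_pos, fun v => by simp [Subsingleton.elim v 0]⟩
  obtain ⟨w, hw, hmin⟩ := (isCompact_sphere (0 : V) 1).exists_isMinOn
    (NormedSpace.sphere_nonempty.2 zero_le_one) hc.continuousOn
  have hw0 : w ≠ 0 := by
    rintro rfl
    simp at hw
  refine ⟨Q w, hQ w hw0, fun v => ?_⟩
  rcases eq_or_ne v 0 with rfl | hv
  · simp
  have hn : ‖v‖ ≠ 0 := norm_ne_zero_iff.2 hv
  have h1 : Q w ≤ Q (‖v‖⁻¹ • v) := hmin (by simp [norm_smul, hn])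
  rw [QuadraticMap.map_smul, smul_eq_mul] at h1
  have h2 : (0 : ℝ) < ‖v‖ ^ 2 := by positivity
  calc Q w * ‖v‖ ^ 2 ≤ (‖v‖⁻¹ * ‖v‖⁻¹ * Q v) * ‖v‖ ^ 2 := by gcongr
    _ = Q v := by field_simp

omit [FiniteDimensional ℝ V] in
-- Test the subgradient on the segment from `u` to `v`, divide by `t`, and let `t` tend to `0`: the
-- quadratic gain survives with factor `1`.
theorem subgradient_add_quadratic_le {f : V → ℝ} {Q : QuadraticForm ℝ V}
    (hf : ∀ u v : V, ∀ t ∈ Icc (0 : ℝ) 1,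
      f (t • v + (1 - t) • u) ≤ t * f v + (1 - t) * f u - t * (1 - t) * Q (u - v))
    {η : Module.Dual ℝ V} {u : V} (hη : η ∈ subdifferential f u) (v : V) :
    η (v - u) + Q (u - v) ≤ f v - f u := by
  have key : ∀ t ∈ Ioo (0 : ℝ) 1, η (v - u) + (1 - t) * Q (u - v) ≤ f v - f u := by
    intro t ht
    have h1 := hf u v t (Ioo_subset_Icc_self ht)
    have h2 := hη (t • v + (1 - t) • u)
    have h3 : t • v + (1 - t) • u - u = t • (v - u) := by module
    rw [h3, map_smul, smul_eq_mul] at h2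
    have h4 : t * (η (v - u) + (1 - t) * Q (u - v)) ≤ t * (f v - f u) := by linarith
    exact le_of_mul_le_mul_left h4 ht.1
  have hlim : Tendsto (fun t : ℝ => η (v - u) + (1 - t) * Q (u - v)) (𝓝[>] 0)
      (𝓝 (η (v - u) + (1 - 0) * Q (u - v))) := by
    refine Tendsto.mono_left ?_ nhdsWithin_le_nhds
    exact (Continuous.tendsto (by fun_prop) 0)
  have := le_of_tendsto hlim (mem_of_superset (Ioo_mem_nhdsGT one_pos) key)
  linarith

/-- Quadratic growth beats a linear functional, so `f - η` is coercive; a minimizer is the required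
point. -/
theorem exists_mem_subdifferential {f : V → ℝ} (hf : Continuous f) {a : ℝ} (ha : 0 < a)
    (hfa : ∀ v, a * ‖v‖ ^ 2 ≤ f v) (η : V →L[ℝ] ℝ) :
    ∃ u, (η : Module.Dual ℝ V) ∈ subdifferential f u := by
  have hlim : Tendsto (fun v => f v - η v) (cocompact V) atTop := by
    have h1 : Tendsto (fun r : ℝ => r * (a * r - ‖η‖)) atTop atTop :=
      tendsto_id.atTop_mul_atTop₀
        (tendsto_atTop_add_const_right _ _ (tendsto_id.const_mul_atTop ha))
    refine tendsto_atTop_mono (fun v => ?_) (h1.comp (tendsto_norm_cocompact_atTop (E := V)))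
    have h2 : η v ≤ ‖η‖ * ‖v‖ := (le_abs_self _).trans (η.le_opNorm v)
    have h3 := hfa v
    simp only [Function.comp_apply]
    nlinarith
  obtain ⟨u, hu⟩ := (hf.sub η.continuous).exists_forall_le hlim
  refine ⟨u, fun v => ?_⟩
  have := hu v
  simp only [Pi.sub_apply] at this
  simp only [ContinuousLinearMap.coe_coe, map_sub]
  linarith

omit [FiniteDimensional ℝ V] in
-- Euler's identity for a 2-homogeneous function: test on the ray `s • u`, divide by `s - 1`, and
-- let `s` tend to `1` from both sides.
theorem apply_eq_sq_of_mem_subdifferential (n : Seminorm ℝ V) {η : Module.Dual ℝ V} {u : V}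
    (hη : η ∈ subdifferential (fun v => (1 / 2) * n v ^ 2) u) : η u = n u ^ 2 := by
  have key : ∀ s : ℝ, 0 < s → (s - 1) * η u ≤ (s - 1) * ((s + 1) * (1 / 2 * n u ^ 2)) := by
    intro s hs
    have h1 := hη (s • u)
    have h2 : s • u - u = (s - 1) • u := by module
    simp only [h2, map_smul, smul_eq_mul, map_smul_eq_mul, Real.norm_eq_abs, abs_of_pos hs] at h1
    linarith
  have hup : ∀ s : ℝ, 1 < s → η u ≤ (s + 1) * (1 / 2 * n u ^ 2) := fun s hs =>
    le_of_mul_le_mul_left (key s (by linarith)) (by linarith)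
  have hlo : ∀ s ∈ Ioo (0 : ℝ) 1, (s + 1) * (1 / 2 * n u ^ 2) ≤ η u := fun s hs => by
    have := key s hs.1
    have h3 : (1 - s) * ((s + 1) * (1 / 2 * n u ^ 2)) ≤ (1 - s) * η u := by linarith
    exact le_of_mul_le_mul_left h3 (by linarith [hs.2])
  have hlim : Tendsto (fun s : ℝ => (s + 1) * (1 / 2 * n u ^ 2)) (𝓝 1)
      (𝓝 ((1 + 1) * (1 / 2 * n u ^ 2))) := Continuous.tendsto (by fun_prop) 1
  have h1 := ge_of_tendsto (hlim.mono_left (nhdsWithin_le_nhds (s := Ioi 1)))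
    (mem_of_superset self_mem_nhdsWithin hup)
  have h2 := le_of_tendsto (hlim.mono_left (nhdsWithin_le_nhds (s := Iio 1)))
    (mem_of_superset (Ioo_mem_nhdsLT one_pos) hlo)
  linarith

end Convex

/-! ### The gradient of the dual energy -/

section EnergyGradient

variable {E : Type*} [NormedAddCommGroup E] [NormedSpace ℝ E]

/-- `P` behaves like the gradient of the dual energy `H`: it is a Lipschitz selection of the
subdifferential of `H`, and it is controlled by `H`. -/
structure IsEnergyGradient (P : (E →L[ℝ] ℝ) → E) (H : (E →L[ℝ] ℝ) → ℝ) : Prop where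
  lipschitz : ∃ K : ℝ≥0, LipschitzWith K P
  subgradient : ∀ μ μ', (μ' - μ) (P μ) ≤ H μ' - H μ
  bound : ∃ c : ℝ, 0 ≤ c ∧ ∀ μ, ‖P μ‖ ^ 2 ≤ c * H μ

theorem exists_isEnergyGradient [FiniteDimensional ℝ E] (V : Submodule ℝ E) (n : Seminorm ℝ V)
    (hn : IsStronglyConvexFun (fun v => (1 / 2) * n v ^ 2)) :
    ∃ (P : (E →L[ℝ] ℝ) → V) (H : (E →L[ℝ] ℝ) → ℝ),
      IsEnergyGradient (fun μ => (P μ : E)) H ∧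
      ∀ (μ : E →L[ℝ] ℝ) (u : V), ((μ : Module.Dual ℝ E) ∘ₗ V.subtype) ∈
        subdifferential (fun v => (1 / 2) * n v ^ 2) u ↔ u = P μ := by
  obtain ⟨Q, hQ, hf⟩ := hn
  obtain ⟨a, ha, hQa⟩ := QuadraticMap.PosDef.exists_mul_sq_norm_le hQ
  set f : V → ℝ := fun v => (1 / 2) * n v ^ 2 with hfdef
  have hnc : Continuous n := by
    rw [← continuousOn_univ]
    exact n.convexOn.continuousOn isOpen_univ
  have hfa : ∀ v, a * ‖v‖ ^ 2 ≤ f v := by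
    intro v
    -- The midpoint of `v` and `-v` is `0`, where the energy vanishes, so strong convexity there
    -- reads `Q v ≤ f v`.
    have h1 := hf v (-v) (1 / 2) (by norm_num)
    have h2 : (1 / 2 : ℝ) • -v + (1 - 1 / 2 : ℝ) • v = 0 := by module
    have h3 : v - -v = (2 : ℝ) • v := by module
    rw [h2, h3, QuadraticMap.map_smul] at h1
    simp only [hfdef, map_neg_eq_map, map_zero, smul_eq_mul] at h1 ⊢
    linarith [hQa v]
  have hex : ∀ μ : E →L[ℝ] ℝ, ∃ u, ((μ : Module.Dual ℝ E) ∘ₗ V.subtype) ∈ subdifferential f u :=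
    fun μ => exists_mem_subdifferential (by fun_prop) ha hfa (μ.comp V.subtypeL)
  choose P hP using hex
  -- Adding the two improved subgradient inequalities cancels `f` and leaves strong monotonicity.
  -- The case `μ = μ'` gives uniqueness of the subgradient's base point.
  have hlip : ∀ (μ μ' : E →L[ℝ] ℝ) (u u' : V),
      ((μ : Module.Dual ℝ E) ∘ₗ V.subtype) ∈ subdifferential f u →
      ((μ' : Module.Dual ℝ E) ∘ₗ V.subtype) ∈ subdifferential f u' →
      ‖u - u'‖ ≤ a⁻¹ * ‖μ - μ'‖ := by
    intro μ μ' u u' h h'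
    have h1 := subgradient_add_quadratic_le hf h u'
    have h2 := subgradient_add_quadratic_le hf h' u
    have h3 := hQa (u - u')
    have h4 := hQa (u' - u)
    rw [norm_sub_rev u' u] at h4
    have h5 : (μ - μ') ((u : E) - u') ≤ ‖μ - μ'‖ * ‖u - u'‖ :=
      (le_abs_self _).trans ((μ - μ').le_opNorm _)
    simp only [LinearMap.comp_apply, Submodule.subtype_apply, ContinuousLinearMap.coe_coe,
      map_sub, sub_apply] at h1 h2 h5
    rcases (norm_nonneg (u - u')).eq_or_lt' with h6 | h6
    · rw [h6]; positivity
    rw [inv_mul_eq_div, le_div_iff₀ ha]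
    have h7 : ‖u - u'‖ * (‖u - u'‖ * a) ≤ ‖u - u'‖ * ‖μ - μ'‖ := by nlinarith
    exact le_of_mul_le_mul_left h7 h6
  have hsq : ∀ μ, μ (P μ) = n (P μ) ^ 2 := fun μ => apply_eq_sq_of_mem_subdifferential n (hP μ)
  refine ⟨P, fun μ => f (P μ), ⟨⟨⟨a⁻¹, by positivity⟩, ?_⟩, ?_, ⟨a⁻¹, by positivity, ?_⟩⟩, ?_⟩
  · refine LipschitzWith.of_dist_le_mul fun μ μ' => ?_
    rw [dist_eq_norm, dist_eq_norm]
    exact hlip μ μ' _ _ (hP μ) (hP μ')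
  · intro μ μ'
    -- By Euler's identity `H μ = μ (P μ) - f (P μ)`, the Legendre transform of `f`, so the claim is
    -- the Fenchel-Young inequality.
    have h1 := hP μ' (P μ)
    have h2 := hsq μ
    have h3 := hsq μ'
    simp only [LinearMap.comp_apply, Submodule.subtype_apply, ContinuousLinearMap.coe_coe,
      map_sub, hfdef, sub_apply] at h1 ⊢
    linarith
  · intro μ
    have := hfa (P μ)
    rw [inv_mul_eq_div, le_div_iff₀ ha]
    simpa [mul_comm] using this
  · intro μ u
    refine ⟨fun h => ?_, fun h => h ▸ hP μ⟩
    have := hlip μ μ u (P μ) h (hP μ)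
    rw [sub_self, norm_zero, mul_zero] at this
    exact sub_eq_zero.1 (norm_le_zero_iff.1 this)

end EnergyGradient

/-! ### Second derivatives -/

section SecondDerivative

variable {E F : Type*} [NormedAddCommGroup E] [NormedSpace ℝ E] [NormedAddCommGroup F]
  [NormedSpace ℝ F]

theorem fderiv_fderiv_apply_self_eq_zero {f : E → F} {p v : E} {q w : F}
    (hf : ContDiffAt ℝ 2 f p) (h : ∀ᶠ s : ℝ in 𝓝 0, f (p + s • v) = q + s • w) :
    fderiv ℝ (fderiv ℝ f) p v v = 0 := by
  have hline : ∀ s : ℝ, HasDerivAt (fun s : ℝ => p + s • v) v s := fun s => by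
    simpa using ((hasDerivAt_id s).smul_const v).const_add p
  have hp : p + (0 : ℝ) • v = p := by simp
  have hev : ∀ᶠ s : ℝ in 𝓝 0, ContDiffAt ℝ 2 f (p + s • v) := by
    refine (hline 0).continuousAt.eventually (p := fun z => ContDiffAt ℝ 2 f z) ?_
    simp only [hp]
    exact hf.eventually (by simp)
  have hconst : ∀ᶠ s : ℝ in 𝓝 0, fderiv ℝ f (p + s • v) v = w := by
    filter_upwards [hev, eventually_eventually_nhds.2 h] with s hs hs'
    have h1 : HasDerivAt (fun s : ℝ => f (p + s • v)) (fderiv ℝ f (p + s • v) v) s :=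
      ((hs.differentiableAt (by simp)).hasFDerivAt).comp_hasDerivAt s (hline s)
    have h2 : HasDerivAt (fun s : ℝ => q + s • w) w s := by
      simpa using ((hasDerivAt_id s).smul_const w).const_add q
    exact h1.unique (h2.congr_of_eventuallyEq hs')
  have hd : DifferentiableAt ℝ (fderiv ℝ f) p :=
    (hf.fderiv_right (m := 1) (by norm_num)).differentiableAt (by simp)
  have h1 : HasDerivAt (fun s : ℝ => fderiv ℝ f (p + s • v)) (fderiv ℝ (fderiv ℝ f) p v) 0 := by
    have hd' : HasFDerivAt (fderiv ℝ f) (fderiv ℝ (fderiv ℝ f) p) (p + (0 : ℝ) • v) := by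
      rw [hp]
      exact hd.hasFDerivAt
    exact hd'.comp_hasDerivAt 0 (hline 0)
  have h2 : HasDerivAt (fun s : ℝ => fderiv ℝ f (p + s • v) v)
      (fderiv ℝ (fderiv ℝ f) p v v) 0 := by
    simpa using h1.clm_apply (hasDerivAt_const 0 v)
  exact h2.unique ((hasDerivAt_const 0 w).congr_of_eventuallyEq hconst)

/-- If `F` looks to second order like a conjugation `(x, y) ↦ x y x⁻¹` at the fixed point `(a, a)`,
its mixed second derivative is alternating. -/
theorem fderiv_fderiv_snd_apply_self_eq_zero {f : E → E → E} {a : E}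
    (hf : ContDiffAt ℝ 2 (Function.uncurry f) (a, a)) (hdiag : ∀ᶠ x in 𝓝 a, f x x = x)
    (hright : ∀ᶠ x in 𝓝 a, f x a = a) (hleft : ∀ᶠ x in 𝓝 a, f a x = x) (u : E) :
    fderiv ℝ (fun x => fderiv ℝ (f x) a) a u u = 0 := by
  set g := Function.uncurry f with hg
  have hline : Tendsto (fun s : ℝ => a + s • u) (𝓝 0) (𝓝 a) := by
    have : Continuous fun s : ℝ => a + s • u := by fun_prop
    simpa using this.tendsto 0
  have h1 : fderiv ℝ (fderiv ℝ g) (a, a) (u, u) (u, u) = 0 := by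
    refine fderiv_fderiv_apply_self_eq_zero (q := a) (w := u) hf ?_
    filter_upwards [hline.eventually hdiag] with s hs
    simpa [hg] using hs
  have h2 : fderiv ℝ (fderiv ℝ g) (a, a) (u, 0) (u, 0) = 0 := by
    refine fderiv_fderiv_apply_self_eq_zero (q := a) (w := 0) hf ?_
    filter_upwards [hline.eventually hright] with s hs
    simpa [hg] using hs
  have h3 : fderiv ℝ (fderiv ℝ g) (a, a) (0, u) (0, u) = 0 := by
    refine fderiv_fderiv_apply_self_eq_zero (q := a) (w := u) hf ?_
    filter_upwards [hline.eventually hleft] with s hs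
    simpa [hg] using hs
  -- Polarization: the second derivative vanishes on `(u, u)`, `(u, 0)` and `(0, u)`, so by symmetry
  -- twice its mixed term is zero.
  have h4 : fderiv ℝ (fderiv ℝ g) (a, a) (0, u) (u, 0) =
      fderiv ℝ (fderiv ℝ g) (a, a) (u, 0) (0, u) :=
    hf.isSymmSndFDerivAt (by simp) _ _
  have h5 : ((u, u) : E × E) = (u, 0) + (0, u) := by simp
  rw [h5] at h1
  simp only [map_add, add_apply, h2, h3, h4, zero_add, add_zero] at h1
  have h6 : fderiv ℝ (fderiv ℝ g) (a, a) (u, 0) (0, u) = 0 := by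
    rw [← two_smul ℝ] at h1
    exact (smul_eq_zero.1 h1).resolve_left two_ne_zero
  have hcont : Tendsto (fun x : E => (x, a)) (𝓝 a) (𝓝 (a, a)) :=
    Continuous.tendsto (by fun_prop) a
  have hpart : (fun x => fderiv ℝ (f x) a) =ᶠ[𝓝 a]
      fun x => (fderiv ℝ g (x, a)).comp (ContinuousLinearMap.inr ℝ E E) := by
    filter_upwards [hcont.eventually (hf.eventually (by simp))] with x hx
    have := (hx.differentiableAt (by simp)).hasFDerivAt.comp a (hasFDerivAt_prodMk_right x a)
    exact this.fderiv
  have hd : HasFDerivAt (fderiv ℝ g) (fderiv ℝ (fderiv ℝ g) (a, a)) (a, a) :=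
    ((hf.fderiv_right (m := 1) (by norm_num)).differentiableAt (by simp)).hasFDerivAt
  have h7 := (hd.comp (f := fun x : E => (x, a)) a (hasFDerivAt_prodMk_left a a)).clm_comp
    (hasFDerivAt_const (ContinuousLinearMap.inr ℝ E E) a)
  rw [hpart.fderiv_eq]
  have h8 := h7.fderiv
  simp only [Function.comp_def] at h8
  rw [h8]
  simpa using h6

end SecondDerivative

/-! ### Left translations and the adjoint map in charts -/

section LieGroup

theorem two_le_infty : (2 : ℕ∞ω) ≤ ∞ := by
  have h : ((2 : ℕ∞) : ℕ∞ω) ≤ ((⊤ : ℕ∞) : ℕ∞ω) := WithTop.coe_le_coe.2 le_top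
  exact h

theorem comp_smulRight_one {E F : Type*} [NormedAddCommGroup E] [NormedSpace ℝ E]
    [NormedAddCommGroup F] [NormedSpace ℝ F] {L : E →L[ℝ] F} {v : E} {w : F} (h : L v = w) :
    L.comp ((1 : ℝ →L[ℝ] ℝ).smulRight v) = (1 : ℝ →L[ℝ] ℝ).smulRight w := by
  ext
  simp [h]

theorem comp_toSpanSingleton_eq_smulRight {E F : Type*} [NormedAddCommGroup E] [NormedSpace ℝ E]
    [NormedAddCommGroup F] [NormedSpace ℝ F] {L : E →L[ℝ] F} {v : E} {w : F} (h : L v = w) :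
    L.comp (ContinuousLinearMap.toSpanSingleton ℝ v) = (1 : ℝ →L[ℝ] ℝ).smulRight w := by
  ext
  simp [h]

variable {E : Type*} [NormedAddCommGroup E] [NormedSpace ℝ E]
  {G : Type*} [TopologicalSpace G] [ChartedSpace E G] [Group G]

/-- The derivative at `1` of left translation by `g`, read in the chart `e` at `g`. -/
def chartMulDeriv (e : OpenPartialHomeomorph G E) (g : G) : E →L[ℝ] E :=
  mfderiv 𝓘(ℝ, E) 𝓘(ℝ, E) (fun h : G => e (g * h)) 1

/-- The adjoint map `Ad_g`, as an endomorphism of the model space. -/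
def modelAd (E : Type*) [NormedAddCommGroup E] [NormedSpace ℝ E]
    {G : Type*} [TopologicalSpace G] [ChartedSpace E G] [Group G] (g : G) : E →L[ℝ] E :=
  lieAd E g

/-- `γ` has, at time `t`, the velocity `dL_{γ(t)} v`. -/
def HasLeftVelocity (γ : ℝ → G) (s : Set ℝ) (t : ℝ) (v : E) : Prop :=
  HasMFDerivWithinAt 𝓘(ℝ, ℝ) 𝓘(ℝ, E) γ s t
    ((1 : ℝ →L[ℝ] ℝ).smulRight
      (mulInvariantVectorField (I := 𝓘(ℝ, E)) (v : GroupLieAlgebra 𝓘(ℝ, E) G) (γ t)))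

variable [LieGroup 𝓘(ℝ, E) ∞ G]


omit [LieGroup 𝓘(ℝ, E) ∞ G] in
theorem chartMulDeriv_eq_fderiv {e : OpenPartialHomeomorph G E} {g : G}
    (h : MDifferentiableAt 𝓘(ℝ, E) 𝓘(ℝ, E) (fun h : G => e (g * h)) 1) :
    chartMulDeriv e g =
      fderiv ℝ (fun y => e (g * (chartAt E (1 : G)).symm y)) (chartAt E (1 : G) 1) := by
  refine (MDifferentiableAt.mfderiv h).trans ?_
  simp only [writtenInExtChartAt, mfld_simps, fderivWithin_univ, Function.comp_def]
  rfl

theorem mdifferentiableAt_const_mul (g h : G) :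
    MDifferentiableAt 𝓘(ℝ, E) 𝓘(ℝ, E) (fun h : G => g * h) h :=
  (contMDiff_mul_left (I := 𝓘(ℝ, E)) (n := ∞)).contMDiffAt.mdifferentiableAt (by simp)

theorem isManifold_one : IsManifold 𝓘(ℝ, E) 1 G := .of_le (n := ∞) (by simp)

theorem mfderiv_chart_mulInvariantVectorField {e : OpenPartialHomeomorph G E}
    (he : e ∈ atlas E G) {g : G} (hg : g ∈ e.source) (v : E) :
    mfderiv 𝓘(ℝ, E) 𝓘(ℝ, E) e g (mulInvariantVectorField (I := 𝓘(ℝ, E)) v g) =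
      chartMulDeriv e g v := by
  have := isManifold_one (E := E) (G := G)
  rw [chartMulDeriv]
  have h := mfderiv_comp_apply_of_eq (x := (1 : G)) (g := e) (f := fun h : G => g * h) (y := g)
    (mdifferentiableAt_atlas (I := 𝓘(ℝ, E)) he hg) (mdifferentiableAt_const_mul g 1) (by simp) v
  exact h.symm

theorem HasLeftVelocity.hasDerivWithinAt {γ : ℝ → G} {s : Set ℝ} {t : ℝ} {v : E}
    (h : HasLeftVelocity γ s t v) {e : OpenPartialHomeomorph G E} (he : e ∈ atlas E G)
    (ht : γ t ∈ e.source) :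
    HasDerivWithinAt (fun t => e (γ t)) (chartMulDeriv e (γ t) v) s t := by
  have := isManifold_one (E := E) (G := G)
  have h1 : MDifferentiableAt 𝓘(ℝ, E) 𝓘(ℝ, E) e (γ t) := mdifferentiableAt_atlas he ht
  have h2 := (h1.hasMFDerivAt.comp_hasMFDerivWithinAt t h).hasFDerivWithinAt
  have h3 := comp_smulRight_one (E := E) (F := E) (mfderiv_chart_mulInvariantVectorField he ht v)
  have h4 : HasFDerivWithinAt (fun t => e (γ t))
      ((1 : ℝ →L[ℝ] ℝ).smulRight (chartMulDeriv e (γ t) v)) s t := by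
    rw [← h3]
    exact h2
  simpa using h4.hasDerivWithinAt

theorem mfderiv_symm_chartMulDeriv {e : OpenPartialHomeomorph G E}
    (he : e ∈ atlas E G) {g : G} (hg : g ∈ e.source) (v : E) :
    mfderiv 𝓘(ℝ, E) 𝓘(ℝ, E) e.symm (e g) (chartMulDeriv e g v) =
      mulInvariantVectorField (I := 𝓘(ℝ, E)) v g := by
  have := isManifold_one (E := E) (G := G)
  rw [← mfderiv_chart_mulInvariantVectorField he hg]
  have h := OpenPartialHomeomorph.MDifferentiable.symm_comp_deriv
    (mdifferentiable_of_mem_atlas (I := 𝓘(ℝ, E)) he) hg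
  exact DFunLike.congr_fun h (mulInvariantVectorField (I := 𝓘(ℝ, E)) v g)

theorem hasLeftVelocity_symm {x : ℝ → E} {s : Set ℝ} {t : ℝ} {v : E}
    {e : OpenPartialHomeomorph G E} (he : e ∈ atlas E G) (ht : x t ∈ e.target)
    (h : HasDerivWithinAt x (chartMulDeriv e (e.symm (x t)) v) s t) :
    HasLeftVelocity (fun t => e.symm (x t)) s t v := by
  have := isManifold_one (E := E) (G := G)
  have h1 : MDifferentiableAt 𝓘(ℝ, E) 𝓘(ℝ, E) e.symm (x t) := mdifferentiableAt_atlas_symm he ht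
  have h2 := h1.hasMFDerivAt.comp_hasMFDerivWithinAt t h.hasFDerivWithinAt.hasMFDerivWithinAt
  have h3 := mfderiv_symm_chartMulDeriv he (e.map_target ht) v
  rw [e.right_inv ht] at h3
  refine HasMFDerivWithinAt.congr_mfderiv h2 ?_
  exact comp_toSpanSingleton_eq_smulRight (E := E) (F := E) h3

/-- Left invariance of the fields; this is what reduces existence to curves issued from `1`. -/
theorem HasLeftVelocity.const_mul {γ : ℝ → G} {s : Set ℝ} {t : ℝ} {v : E}
    (h : HasLeftVelocity γ s t v) (g : G) : HasLeftVelocity (fun t => g * γ t) s t v := by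
  have h2 := (mdifferentiableAt_const_mul (E := E) g (γ t)).hasMFDerivAt.comp_hasMFDerivWithinAt t h
  have h3 := mfderiv_comp_apply_of_eq (x := (1 : G)) (g := fun h : G => g * h)
    (f := fun h : G => γ t * h) (y := γ t)
    (mdifferentiableAt_const_mul (E := E) g _) (mdifferentiableAt_const_mul (γ t) 1) (by simp) v
  have h4 : (fun h : G => g * h) ∘ (fun h : G => γ t * h) = fun h => g * γ t * h := by
    ext; simp [mul_assoc]
  rw [h4] at h3
  refine HasMFDerivWithinAt.congr_mfderiv h2 ?_
  exact comp_smulRight_one (E := E) (F := E) h3.symm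

theorem contMDiffAt_chart_of_mem_atlas {e : OpenPartialHomeomorph G E} (he : e ∈ atlas E G) {g : G}
    (hg : g ∈ e.source) : ContMDiffAt 𝓘(ℝ, E) 𝓘(ℝ, E) ∞ e g :=
  contMDiffAt_of_mem_maximalAtlas (IsManifold.subset_maximalAtlas he) hg

theorem contMDiffAt_symm_of_mem_atlas {e : OpenPartialHomeomorph G E} (he : e ∈ atlas E G) {x : E}
    (hx : x ∈ e.target) : ContMDiffAt 𝓘(ℝ, E) 𝓘(ℝ, E) ∞ e.symm x :=
  contMDiffAt_symm_of_mem_maximalAtlas (IsManifold.subset_maximalAtlas he) hx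

/-- Products, read in charts, are smooth. -/
theorem contDiffAt_chart_mul {e : OpenPartialHomeomorph G E} (he : e ∈ atlas E G) {x : E}
    (hx : x ∈ e.target) :
    ContDiffAt ℝ ∞ (Function.uncurry fun x y => e (e.symm x * (chartAt E (1 : G)).symm y))
      (x, chartAt E (1 : G) 1) := by
  have h1 : ContMDiffAt 𝓘(ℝ, E × E) 𝓘(ℝ, E) ∞ (fun p : E × E => e.symm p.1)
      (x, chartAt E (1 : G) 1) :=
    ContMDiffAt.comp (I' := 𝓘(ℝ, E)) _ (contMDiffAt_symm_of_mem_atlas he hx)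
      contDiff_fst.contMDiff.contMDiffAt
  have h2 : ContMDiffAt 𝓘(ℝ, E × E) 𝓘(ℝ, E) ∞
      (fun p : E × E => (chartAt E (1 : G)).symm p.2) (x, chartAt E (1 : G) 1) :=
    ContMDiffAt.comp (I' := 𝓘(ℝ, E)) _
      (contMDiffAt_symm_of_mem_atlas (chart_mem_atlas E 1) (mem_chart_target E 1))
      contDiff_snd.contMDiff.contMDiffAt
  refine ContMDiffAt.contDiffAt (ContMDiffAt.comp (I' := 𝓘(ℝ, E)) (g := e) _ ?_ (h1.mul h2))
  refine contMDiffAt_chart_of_mem_atlas he ?_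
  simpa using e.map_target hx

/-- Conjugations, read in charts, are smooth. -/
theorem contDiffAt_chart_conj {e : OpenPartialHomeomorph G E} (he : e ∈ atlas E G) {x : E}
    (hx : x ∈ e.target) :
    ContDiffAt ℝ ∞ (Function.uncurry fun x y => (chartAt E (1 : G))
      (e.symm x * (chartAt E (1 : G)).symm y * (e.symm x)⁻¹)) (x, chartAt E (1 : G) 1) := by
  have h1 : ContMDiffAt 𝓘(ℝ, E × E) 𝓘(ℝ, E) ∞ (fun p : E × E => e.symm p.1)
      (x, chartAt E (1 : G) 1) :=
    ContMDiffAt.comp (I' := 𝓘(ℝ, E)) _ (contMDiffAt_symm_of_mem_atlas he hx)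
      contDiff_fst.contMDiff.contMDiffAt
  have h2 : ContMDiffAt 𝓘(ℝ, E × E) 𝓘(ℝ, E) ∞
      (fun p : E × E => (chartAt E (1 : G)).symm p.2) (x, chartAt E (1 : G) 1) :=
    ContMDiffAt.comp (I' := 𝓘(ℝ, E)) _
      (contMDiffAt_symm_of_mem_atlas (chart_mem_atlas E 1) (mem_chart_target E 1))
      contDiff_snd.contMDiff.contMDiffAt
  refine ContMDiffAt.contDiffAt (ContMDiffAt.comp (I' := 𝓘(ℝ, E)) (g := chartAt E (1 : G)) _ ?_
    ((h1.mul h2).mul h1.inv))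
  exact contMDiffAt_chart_of_mem_atlas (chart_mem_atlas E 1) (by simp)

theorem chartMulDeriv_symm_eq_fderiv {e : OpenPartialHomeomorph G E} (he : e ∈ atlas E G) {x : E}
    (hx : x ∈ e.target) :
    chartMulDeriv e (e.symm x) =
      fderiv ℝ (fun y => e (e.symm x * (chartAt E (1 : G)).symm y)) (chartAt E (1 : G) 1) := by
  have := isManifold_one (E := E) (G := G)
  refine chartMulDeriv_eq_fderiv ?_
  refine MDifferentiableAt.comp (I' := 𝓘(ℝ, E)) (1 : G) ?_ (mdifferentiableAt_const_mul _ _)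
  exact mdifferentiableAt_atlas he (by simpa using e.map_target hx)

theorem contDiffOn_chartMulDeriv {e : OpenPartialHomeomorph G E} (he : e ∈ atlas E G) :
    ContDiffOn ℝ 1 (fun x => chartMulDeriv e (e.symm x)) e.target := by
  refine ContDiffOn.congr (fun x hx => ?_) fun x hx => chartMulDeriv_symm_eq_fderiv he hx
  -- The `y`-derivative of a jointly `C^2` map is `C^1` in the parameter `x`.
  exact (ContDiffAt.fderiv (n := 2) ((contDiffAt_chart_mul he hx).of_le two_le_infty)
    contDiffAt_const (by norm_num)).contDiffWithinAt

theorem modelAd_symm_eq_fderiv {e : OpenPartialHomeomorph G E} (x : E) :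
    modelAd E (e.symm x) = fderiv ℝ (fun y => (chartAt E (1 : G))
      (e.symm x * (chartAt E (1 : G)).symm y * (e.symm x)⁻¹)) (chartAt E (1 : G) 1) := by
  have h : MDifferentiableAt 𝓘(ℝ, E) 𝓘(ℝ, E) (fun h : G => e.symm x * h * (e.symm x)⁻¹) 1 := by
    refine ContMDiffAt.mdifferentiableAt (n := ∞) ?_ (by simp)
    exact (contMDiffAt_const.mul contMDiffAt_id).mul contMDiffAt_const
  refine (MDifferentiableAt.mfderiv h).trans ?_
  simp only [writtenInExtChartAt, mfld_simps, fderivWithin_univ, Function.comp_def, mul_one,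
    mul_inv_cancel]
  rfl

theorem contDiffOn_modelAd {e : OpenPartialHomeomorph G E} (he : e ∈ atlas E G) :
    ContDiffOn ℝ 1 (fun x => modelAd E (e.symm x)) e.target := by
  refine ContDiffOn.congr (fun x hx => ?_) fun x hx => modelAd_symm_eq_fderiv x
  exact (ContDiffAt.fderiv (n := 2) ((contDiffAt_chart_conj he hx).of_le two_le_infty)
    contDiffAt_const (by norm_num)).contDiffWithinAt

theorem mdifferentiableAt_conj (g h : G) :
    MDifferentiableAt 𝓘(ℝ, E) 𝓘(ℝ, E) (fun h : G => g * h * g⁻¹) h := by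
  refine ContMDiffAt.mdifferentiableAt (n := ∞) ?_ (by simp)
  exact (contMDiffAt_const.mul contMDiffAt_id).mul contMDiffAt_const

theorem modelAd_mul (g h : G) : modelAd E (g * h) = (modelAd E g).comp (modelAd E h) := by
  ext v
  have h3 := mfderiv_comp_apply_of_eq (x := (1 : G)) (g := fun k : G => g * k * g⁻¹)
    (f := fun k : G => h * k * h⁻¹) (y := 1) (mdifferentiableAt_conj (E := E) g _)
    (mdifferentiableAt_conj h 1) (by simp) v
  have h4 : (fun k : G => g * k * g⁻¹) ∘ (fun k : G => h * k * h⁻¹) =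
      fun k => g * h * k * (g * h)⁻¹ := by
    ext; simp [mul_assoc]
  rw [h4] at h3
  exact h3

theorem chartMulDeriv_one (v : E) : chartMulDeriv (chartAt E (1 : G)) 1 v = v := by
  have h := chartMulDeriv_symm_eq_fderiv (chart_mem_atlas E (1 : G)) (mem_chart_target E (1 : G))
  rw [OpenPartialHomeomorph.left_inv _ (mem_chart_source E (1 : G))] at h
  rw [h]
  have h2 : (fun y => (chartAt E (1 : G)) (1 * (chartAt E (1 : G)).symm y))
      =ᶠ[𝓝 (chartAt E (1 : G) 1)] id := by
    filter_upwards [(chartAt E (1 : G)).open_target.mem_nhds (mem_chart_target E (1 : G))] with y hy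
    simp [(chartAt E (1 : G)).right_inv hy]
  rw [h2.fderiv_eq, fderiv_id]
  rfl

/-- The derivative of `Ad` at the identity is alternating. -/
theorem fderiv_modelAd_apply_self (u : E) :
    fderiv ℝ (fun x => modelAd E ((chartAt E (1 : G)).symm x)) (chartAt E (1 : G) 1) u u = 0 := by
  set φ := chartAt E (1 : G) with hφ
  have h1 : (fun x => modelAd E (φ.symm x)) = fun x => fderiv ℝ (fun y => φ
      (φ.symm x * φ.symm y * (φ.symm x)⁻¹)) (φ 1) := funext fun x => modelAd_symm_eq_fderiv x
  rw [h1]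
  have htgt : ∀ᶠ x in 𝓝 (φ 1), x ∈ φ.target := φ.open_target.mem_nhds (mem_chart_target E (1 : G))
  have hone : φ.symm (φ 1) = 1 := φ.left_inv (mem_chart_source E (1 : G))
  refine fderiv_fderiv_snd_apply_self_eq_zero
    ((contDiffAt_chart_conj (chart_mem_atlas E (1 : G)) (mem_chart_target E (1 : G))).of_le
      two_le_infty) ?_ ?_ ?_ u
  · filter_upwards [htgt] with x hx
    simpa using φ.right_inv hx
  · filter_upwards with x
    simp
  · filter_upwards [htgt] with x hx
    simpa [hone] using φ.right_inv hx

/-- Along a curve with velocity `dL_{γ} (c u)`, the derivative of `Ad_γ` kills `u`. -/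
theorem HasLeftVelocity.exists_hasDerivWithinAt_modelAd {γ : ℝ → G} {s : Set ℝ} {t : ℝ} {u : E}
    {c : ℝ} (h : HasLeftVelocity γ s t (c • u)) :
    ∃ D : E →L[ℝ] E, HasDerivWithinAt (fun t => modelAd E (γ t)) D s t ∧ D u = 0 := by
  set φ := chartAt E (1 : G) with hφ
  set B : E → E →L[ℝ] E := fun x => modelAd E (φ.symm x) with hB
  have hone : (γ t)⁻¹ * γ t = 1 := by simp
  -- Move the curve to the identity by `Ad_{γ(τ)} = Ad_{γ(t)} ∘ Ad_{γ(t)⁻¹ γ(τ)}`; only the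
  -- derivative of `Ad` at `1` is then needed.
  have h1 := (h.const_mul (γ t)⁻¹).hasDerivWithinAt (chart_mem_atlas E (1 : G))
    (by rw [hone]; exact mem_chart_source E 1)
  rw [hone, chartMulDeriv_one] at h1
  have hBd : HasFDerivAt B (fderiv ℝ B (φ 1)) (φ 1) :=
    (((contDiffOn_modelAd (chart_mem_atlas E (1 : G))).contDiffAt
      (φ.open_target.mem_nhds (mem_chart_target E (1 : G)))).differentiableAt
        (by simp)).hasFDerivAt
  have hBd' : HasFDerivAt B (fderiv ℝ B (φ 1)) (φ ((γ t)⁻¹ * γ t)) := by rwa [hone]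
  have h2 := hBd'.comp_hasDerivWithinAt t h1
  have h3 := (hasDerivWithinAt_const t s (modelAd E (γ t))).clm_comp h2
  refine ⟨_, h3.congr_of_eventuallyEq ?_ ?_, ?_⟩
  · have hcont : ContinuousWithinAt (fun τ => (γ t)⁻¹ * γ τ) s t :=
      (h.const_mul (γ t)⁻¹).continuousWithinAt
    have hmem : φ.source ∈ 𝓝 ((γ t)⁻¹ * γ t) := by
      rw [hone]
      exact φ.open_source.mem_nhds (mem_chart_source E (1 : G))
    filter_upwards [hcont hmem] with τ hτ
    simp only [hB, Function.comp_apply]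
    rw [φ.left_inv hτ, ← modelAd_mul]
    simp
  · simp only [hB, Function.comp_apply]
    rw [hone, φ.left_inv (mem_chart_source E (1 : G)), ← modelAd_mul, mul_one]
  · have := fderiv_modelAd_apply_self (E := E) (G := G) u
    simp [hB, hφ, this]

end LieGroup

/-! ### Ordinary differential equations -/

section ODE

variable {E F : Type*} [NormedAddCommGroup E] [NormedSpace ℝ E] [NormedAddCommGroup F]
  [NormedSpace ℝ F]

theorem LocallyLipschitzOn.clm_apply {X : Type*} [PseudoEMetricSpace X] {A : X → E →L[ℝ] F}
    {w : X → E} {s : Set X} (hA : LocallyLipschitzOn s A) (hw : LocallyLipschitzOn s w) :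
    LocallyLipschitzOn s (fun x => A x (w x)) := by
  intro x hx
  obtain ⟨K₁, t₁, ht₁, h₁⟩ := hA hx
  obtain ⟨K₂, t₂, ht₂, h₂⟩ := hw hx
  have hA' : ∀ᶠ y in 𝓝[s] x, ‖A y‖₊ < ‖A x‖₊ + 1 :=
    ((hA.continuousOn x hx).nnnorm).eventually (gt_mem_nhds (by simp))
  have hw' : ∀ᶠ y in 𝓝[s] x, ‖w y‖₊ < ‖w x‖₊ + 1 :=
    ((hw.continuousOn x hx).nnnorm).eventually (gt_mem_nhds (by simp))
  refine ⟨K₁ * (‖w x‖₊ + 1) + (‖A x‖₊ + 1) * K₂, _,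
    inter_mem (inter_mem ht₁ ht₂) (inter_mem hA' hw'), ?_⟩
  rintro y ⟨⟨hy₁, hy₂⟩, hyA, hyw⟩ z ⟨⟨hz₁, hz₂⟩, hzA, hzw⟩
  have e1 : edist (A y (w y)) (A z (w y)) ≤ K₁ * edist y z * (‖w x‖₊ + 1) := by
    have : edist (A y (w y)) (A z (w y)) ≤ edist (A y) (A z) * ‖w y‖ₑ := by
      rw [edist_eq_enorm_sub, edist_eq_enorm_sub, ← sub_apply]
      exact (A y - A z).le_opENorm _
    refine this.trans (mul_le_mul' (h₁ hy₁ hz₁) ?_)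
    have h : (‖w y‖₊ : ENNReal) ≤ ((‖w x‖₊ + 1 : ℝ≥0) : ENNReal) :=
      ENNReal.coe_le_coe.2 (le_of_lt hyw)
    rw [enorm_eq_nnnorm]
    exact_mod_cast h
  have e2 : edist (A z (w y)) (A z (w z)) ≤ (‖A x‖₊ + 1) * (K₂ * edist y z) := by
    have : edist (A z (w y)) (A z (w z)) ≤ ‖A z‖ₑ * edist (w y) (w z) := by
      rw [edist_eq_enorm_sub, edist_eq_enorm_sub, ← map_sub]
      exact (A z).le_opENorm _
    refine this.trans (mul_le_mul' ?_ (h₂ hy₂ hz₂))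
    have h : (‖A z‖₊ : ENNReal) ≤ ((‖A x‖₊ + 1 : ℝ≥0) : ENNReal) :=
      ENNReal.coe_le_coe.2 (le_of_lt hzA)
    rw [enorm_eq_nnnorm]
    exact_mod_cast h
  calc edist (A y (w y)) (A z (w z)) ≤ _ := edist_triangle _ (A z (w y)) _
    _ ≤ K₁ * edist y z * (‖w x‖₊ + 1) + (‖A x‖₊ + 1) * (K₂ * edist y z) := add_le_add e1 e2
    _ = _ := by push_cast; ring

theorem LipschitzWith.comp_locallyLipschitzOn {X Y Z : Type*} [PseudoEMetricSpace X]
    [PseudoEMetricSpace Y] [PseudoEMetricSpace Z] {f : Y → Z} {g : X → Y} {s : Set X} {K : ℝ≥0}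
    (hf : LipschitzWith K f) (hg : LocallyLipschitzOn s g) :
    LocallyLipschitzOn s (fun x => f (g x)) := by
  intro x hx
  obtain ⟨K', t, ht, h⟩ := hg hx
  exact ⟨K * K', t, ht, hf.comp_lipschitzOnWith h⟩

theorem ContDiffOn.locallyLipschitzOn_of_isOpen {f : E → F} {s : Set E} (hs : IsOpen s)
    (hf : ContDiffOn ℝ 1 f s) : LocallyLipschitzOn s f := by
  intro x hx
  obtain ⟨K, t, ht, h⟩ := (hf.contDiffAt (hs.mem_nhds hx)).exists_lipschitzOnWith
  exact ⟨K, t, mem_nhdsWithin_of_mem_nhds ht, h⟩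

/-- The scalar by which the radial retraction onto the ball of radius `R` multiplies `v`. -/
def radialFactor (R : ℝ) (v : E) : ℝ := (max 1 (‖v‖ / R))⁻¹

omit [NormedSpace ℝ E] in
theorem radialFactor_eq_one {R : ℝ} (hR : 0 < R) {v : E} (hv : ‖v‖ ≤ R) : radialFactor R v = 1 := by
  rw [radialFactor, max_eq_left ((div_le_one hR).2 hv), inv_one]

theorem norm_radialFactor_smul_le {R : ℝ} (hR : 0 < R) (v : E) : ‖radialFactor R v • v‖ ≤ R := by
  have h1 : 0 < max 1 (‖v‖ / R) := lt_max_of_lt_left one_pos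
  rw [radialFactor, norm_smul, norm_inv, Real.norm_of_nonneg h1.le, inv_mul_le_iff₀ h1]
  rw [← div_le_iff₀ hR]
  exact le_max_right _ _

theorem lipschitzWith_radialFactor_smul {R : ℝ} (hR : 0 < R) :
    LipschitzWith 2 (fun v : E => radialFactor R v • v) := by
  refine LipschitzWith.of_dist_le_mul fun v w => ?_
  rw [dist_eq_norm, dist_eq_norm]
  have hv : 1 ≤ max 1 (‖v‖ / R) := le_max_left _ _
  have hw : 1 ≤ max 1 (‖w‖ / R) := le_max_left _ _
  have hvR : ‖v‖ ≤ max 1 (‖v‖ / R) * R := by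
    rw [← div_le_iff₀ hR]
    exact le_max_right _ _
  have hdiff : |max 1 (‖w‖ / R) - max 1 (‖v‖ / R)| ≤ ‖v - w‖ / R := by
    rw [max_comm, max_comm 1]
    refine (abs_max_sub_max_le_abs _ _ _).trans ?_
    rw [← sub_div, abs_div, abs_of_pos hR]
    gcongr
    rw [norm_sub_rev]
    exact abs_norm_sub_norm_le _ _
  set a := max 1 (‖v‖ / R) with ha
  set b := max 1 (‖w‖ / R) with hb
  -- Each of the two summands is at most `‖v - w‖`, whence the constant `2` for an arbitrary norm.
  have h1 : radialFactor R v • v - radialFactor R w • w =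
      b⁻¹ • (v - w) + ((b - a) * (a⁻¹ * b⁻¹)) • v := by
    have : (b - a) * (a⁻¹ * b⁻¹) = a⁻¹ - b⁻¹ := by field_simp
    rw [radialFactor, radialFactor, ← ha, ← hb, this]
    module
  rw [h1]
  have h2 : ‖b⁻¹ • (v - w)‖ ≤ ‖v - w‖ := by
    rw [norm_smul, norm_inv, Real.norm_of_nonneg (by positivity)]
    exact mul_le_of_le_one_left (norm_nonneg _) (inv_le_one_of_one_le₀ hw)
  have h3 : ‖((b - a) * (a⁻¹ * b⁻¹)) • v‖ ≤ ‖v - w‖ := by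
    rw [norm_smul, norm_mul, norm_mul, norm_inv, norm_inv, Real.norm_eq_abs,
      Real.norm_of_nonneg (by positivity : 0 ≤ a), Real.norm_of_nonneg (by positivity : 0 ≤ b)]
    calc |b - a| * (a⁻¹ * b⁻¹) * ‖v‖ ≤ (‖v - w‖ / R) * (a⁻¹ * 1) * (a * R) := by
          gcongr
          exact inv_le_one_of_one_le₀ hw
      _ = ‖v - w‖ := by field_simp
  calc _ ≤ _ := norm_add_le _ _
    _ ≤ ‖v - w‖ + ‖v - w‖ := add_le_add h2 h3
    _ = ((2 : ℝ≥0) : ℝ) * ‖v - w‖ := by push_cast; ring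

/-- The Picard-Lindelöf theorem, with the information that the solution stays in the ball. -/
theorem IsPicardLindelof.exists_forall_mem_closedBall [CompleteSpace E] {f : ℝ → E → E}
    {tmin tmax : ℝ} {t₀ : Icc tmin tmax} {x₀ : E} {a L K : ℝ≥0}
    (hf : IsPicardLindelof f t₀ x₀ a 0 L K) :
    ∃ α : ℝ → E, α t₀ = x₀ ∧ (∀ t, α t ∈ closedBall x₀ a) ∧
      ∀ t ∈ Icc tmin tmax, HasDerivWithinAt α (f t (α t)) (Icc tmin tmax) t := by
  obtain ⟨α, hα⟩ := ODE.FunSpace.exists_isFixedPt_next hf (mem_closedBall_self le_rfl)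
  refine ⟨α.compProj, by rw [ODE.FunSpace.compProj_val, ← hα, ODE.FunSpace.next_apply₀],
    fun _ => α.compProj_mem_closedBall hf.mul_max_le, fun t ht => ?_⟩
  apply ODE.hasDerivWithinAt_picard_Icc t₀.2 hf.continuousOn_uncurry
    α.continuous_compProj.continuousOn (fun _ _ => α.compProj_mem_closedBall hf.mul_max_le)
    x₀ ht |>.congr_of_mem _ ht
  intro t' ht'
  nth_rw 1 [← hα]
  rw [ODE.FunSpace.compProj_of_mem ht', ODE.FunSpace.next_apply]

/-- An absolutely continuous curve whose derivative agrees almost everywhere with a continuous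
function is differentiable everywhere. -/
theorem AbsolutelyContinuousOnInterval.hasDerivWithinAt_of_ae [CompleteSpace E] {f h : ℝ → E}
    {c d : ℝ} (hcd : c ≤ d) (hf : AbsolutelyContinuousOnInterval f c d)
    (hh : ContinuousOn h (Icc c d))
    (hfh : ∀ᵐ t ∂(volume.restrict (Icc c d)), HasDerivWithinAt f (h t) (Icc c d) t) :
    ∀ t ∈ Icc c d, HasDerivWithinAt f (h t) (Icc c d) t := by
  -- Constant extension past the endpoints makes `k` continuous on the whole line. Its primitive `g`
  -- is `C^1`, and `f - g`, absolutely continuous with zero derivative almost everywhere, is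
  -- constant.
  set k : ℝ → E := IccExtend hcd ((Icc c d).domRestrict h) with hk
  have hkc : Continuous k := (continuousOn_iff_continuous_domRestrict.1 hh).Icc_extend'
  have hkh : ∀ t ∈ Icc c d, k t = h t := fun t ht => IccExtend_of_mem hcd _ ht
  set g : ℝ → E := fun t => ∫ s in c..t, k s with hg
  have hgd : ∀ t, HasDerivAt g (k t) t := fun t => hkc.integral_hasStrictDerivAt c t |>.hasDerivAt
  have hg1 : ContDiff ℝ 1 g := by
    rw [contDiff_one_iff_deriv]
    refine ⟨fun t => (hgd t).differentiableAt, ?_⟩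
    rw [show deriv g = k from funext fun t => (hgd t).deriv]
    exact hkc
  have hsub : AbsolutelyContinuousOnInterval (f - g) c d :=
    hf.sub hg1.contDiffOn.absolutelyContinuousOnInterval
  obtain ⟨C, hC⟩ := hsub.const_of_ae_hasDerivAt_zero (by
    have h1 := (ae_restrict_iff' measurableSet_Icc).1 hfh
    have h2 : ∀ᵐ t : ℝ, t ≠ c := by simp [ae_iff]
    have h3 : ∀ᵐ t : ℝ, t ≠ d := by simp [ae_iff]
    filter_upwards [h1, h2, h3] with t ht htc htd htm
    rw [uIcc_of_le hcd] at htm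
    have h4 := (ht htm).hasDerivAt
      (Icc_mem_nhds (lt_of_le_of_ne htm.1 htc.symm) (lt_of_le_of_ne htm.2 htd))
    simpa [hkh t htm] using h4.sub (hgd t))
  rw [uIcc_of_le hcd] at hC
  intro t ht
  have h5 : HasDerivWithinAt (fun s => g s + C) (h t) (Icc c d) t := by
    rw [← hkh t ht]
    exact ((hgd t).add_const C).hasDerivWithinAt
  refine h5.congr (fun s hs => ?_) ?_
  · rw [← hC s hs]; simp
  · rw [← hC t ht]; simp

/-- The dual energy is constant to first order along curves whose derivative annihilates its
gradient. -/
theorem IsEnergyGradient.hasDerivWithinAt_zero {P : (E →L[ℝ] ℝ) → E} {H : (E →L[ℝ] ℝ) → ℝ}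
    (hP : IsEnergyGradient P H) {η : ℝ → E →L[ℝ] ℝ} {η' : E →L[ℝ] ℝ} {s : Set ℝ} {t : ℝ}
    (hη : HasDerivWithinAt η η' s t) (h0 : η' (P (η t)) = 0) :
    HasDerivWithinAt (fun τ => H (η τ)) 0 s t := by
  obtain ⟨K, hK⟩ := hP.lipschitz
  rw [hasDerivWithinAt_iff_isLittleO]
  simp only [smul_zero, sub_zero]
  have h1 : HasDerivWithinAt (fun τ => η τ (P (η t))) 0 s t := by
    simpa [h0] using hη.clm_apply (hasDerivWithinAt_const t s (P (η t)))
  rw [hasDerivWithinAt_iff_isLittleO] at h1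
  simp only [smul_zero, sub_zero] at h1
  -- The subgradient inequalities at `η t` and `η τ` squeeze the increment of `H`: it differs from
  -- `(η τ - η t) (P (η t))` by at most `K * ‖η τ - η t‖ ^ 2`. Differentiability of `H` is not
  -- needed.
  have h2 : (fun τ => ‖η τ - η t‖ * (K * ‖η τ - η t‖)) =o[𝓝[s] t] fun τ => τ - t := by
    have hO : (fun τ => η τ - η t) =O[𝓝[s] t] fun τ => τ - t :=
      hη.differentiableWithinAt.isBigO_sub
    have ho : (fun τ => K * ‖η τ - η t‖) =o[𝓝[s] t] fun _ => (1 : ℝ) := by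
      rw [Asymptotics.isLittleO_one_iff]
      have : Tendsto (fun τ => η τ - η t) (𝓝[s] t) (𝓝 0) := by
        simpa using hη.continuousWithinAt.tendsto.sub_const (η t)
      simpa using this.norm.const_mul (K : ℝ)
    simpa using hO.norm_left.mul_isLittleO ho
  refine (Asymptotics.IsBigO.of_bound 1 (Eventually.of_forall fun τ => ?_)).trans_isLittleO
    (h1.norm_left.add h2)
  have h3 := hP.subgradient (η t) (η τ)
  have h4 := hP.subgradient (η τ) (η t)
  have h5 : (η τ - η t) (P (η τ) - P (η t)) ≤ ‖η τ - η t‖ * (K * ‖η τ - η t‖) := by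
    refine (le_abs_self _).trans (((η τ - η t).le_opNorm _).trans ?_)
    gcongr
    simpa [dist_eq_norm] using hK.dist_le_mul (η τ) (η t)
  have h6 := le_abs_self (η τ (P (η t)) - η t (P (η t)))
  have h7 := neg_abs_le (η τ (P (η t)) - η t (P (η t)))
  simp only [sub_apply, map_sub] at h3 h4 h5
  have h8 : 0 ≤ ‖η τ - η t‖ * (K * ‖η τ - η t‖) := by positivity
  rw [one_mul, Real.norm_eq_abs, Real.norm_eq_abs, Real.norm_eq_abs,
    abs_of_nonneg (add_nonneg (abs_nonneg _) h8), abs_le]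
  constructor <;> linarith

end ODE

/-! ### The normal flow -/

section NormalFlow

variable {E : Type*} [NormedAddCommGroup E] [NormedSpace ℝ E]
  {G : Type*} [TopologicalSpace G] [ChartedSpace E G] [Group G]
  {P : (E →L[ℝ] ℝ) → E} {H : (E →L[ℝ] ℝ) → ℝ}

/-- The covector `μ ∘ Ad_g`. -/
def coadjoint (μ : E →L[ℝ] ℝ) (g : G) : E →L[ℝ] ℝ := μ.comp (modelAd E g)

/-- `γ` is a solution on `s` of the normal equation `γ' = dL_γ P(μ ∘ Ad_γ)`. -/
def IsNormalSolution (P : (E →L[ℝ] ℝ) → E) (μ : E →L[ℝ] ℝ) (γ : ℝ → G) (s : Set ℝ) : Prop :=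
  ∀ t ∈ s, HasLeftVelocity γ s t (P (coadjoint μ (γ t)))

/-- The normal equation, read in the chart `e`. -/
def normalField (P : (E →L[ℝ] ℝ) → E) (μ : E →L[ℝ] ℝ) (e : OpenPartialHomeomorph G E) (x : E) : E :=
  chartMulDeriv e (e.symm x) (P (coadjoint μ (e.symm x)))

theorem IsNormalSolution.continuousOn {μ : E →L[ℝ] ℝ} {γ : ℝ → G} {s : Set ℝ}
    (h : IsNormalSolution P μ γ s) : ContinuousOn γ s :=
  fun t ht => (h t ht).continuousWithinAt

theorem HasLeftVelocity.congr_mono {γ γ₁ : ℝ → G} {s s' : Set ℝ} {t : ℝ} {v : E}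
    (h : HasLeftVelocity γ s t v) (hs : ∀ τ ∈ s', γ₁ τ = γ τ) (ht : γ₁ t = γ t) (hss : s' ⊆ s) :
    HasLeftVelocity γ₁ s' t v := by
  unfold HasLeftVelocity at h
  refine HasMFDerivWithinAt.congr_mfderiv (h.congr_mono hs ht hss) ?_
  exact congrArg (fun g : G => (1 : ℝ →L[ℝ] ℝ).smulRight
    ((mulInvariantVectorField (I := 𝓘(ℝ, E)) v g : E))) ht.symm

theorem HasLeftVelocity.comp_sub_const {γ : ℝ → G} {a b t T : ℝ} {v : E}
    (h : HasLeftVelocity γ (Icc a b) (t - T) v) :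
    HasLeftVelocity (fun τ => γ (τ - T)) (Icc (T + a) (T + b)) t v := by
  have h1 : HasMFDerivWithinAt 𝓘(ℝ, ℝ) 𝓘(ℝ, ℝ) (fun τ : ℝ => τ - T) (Icc (T + a) (T + b)) t
      (ContinuousLinearMap.id ℝ ℝ) :=
    ((hasFDerivAt_id t).sub_const T).hasFDerivWithinAt.hasMFDerivWithinAt
  unfold HasLeftVelocity at h
  have hmem : Icc (T + a) (T + b) ⊆ (fun τ : ℝ => τ - T) ⁻¹' Icc a b :=
    fun τ hτ => ⟨by linarith [hτ.1], by linarith [hτ.2]⟩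
  exact HasMFDerivWithinAt.comp (f := fun τ : ℝ => τ - T) t h h1 hmem

theorem IsNormalSolution.mono {μ : E →L[ℝ] ℝ} {γ : ℝ → G} {s s' : Set ℝ}
    (h : IsNormalSolution P μ γ s) (hss : s' ⊆ s) : IsNormalSolution P μ γ s' :=
  fun t ht => HasMFDerivWithinAt.mono (h t (hss ht)) hss

theorem modelAd_one : modelAd E (1 : G) = ContinuousLinearMap.id ℝ E := by
  have h : (fun x : G => 1 * x * 1⁻¹) = id := by ext; simp
  rw [modelAd, lieAd, h]
  exact mfderiv_id

theorem coadjoint_one (μ : E →L[ℝ] ℝ) : coadjoint μ (1 : G) = μ := by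
  rw [coadjoint, modelAd_one]
  rfl

variable [LieGroup 𝓘(ℝ, E) ∞ G]

theorem coadjoint_mul (μ : E →L[ℝ] ℝ) (g h : G) :
    coadjoint μ (g * h) = coadjoint (coadjoint μ g) h := by
  rw [coadjoint, modelAd_mul]
  rfl

theorem locallyLipschitzOn_coadjoint (μ : E →L[ℝ] ℝ) {e : OpenPartialHomeomorph G E}
    (he : e ∈ atlas E G) : LocallyLipschitzOn e.target (fun x => coadjoint μ (e.symm x)) := by
  refine ContDiffOn.locallyLipschitzOn_of_isOpen e.open_target ?_
  exact contDiffOn_const.clm_comp (contDiffOn_modelAd he)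

theorem locallyLipschitzOn_normalField {K : ℝ≥0} (hP : LipschitzWith K P) (μ : E →L[ℝ] ℝ)
    {e : OpenPartialHomeomorph G E} (he : e ∈ atlas E G) :
    LocallyLipschitzOn e.target (normalField P μ e) :=
  ((contDiffOn_chartMulDeriv he).locallyLipschitzOn_of_isOpen e.open_target).clm_apply
    (hP.comp_locallyLipschitzOn (locallyLipschitzOn_coadjoint μ he))

theorem continuousOn_coadjoint (μ : E →L[ℝ] ℝ) {γ : ℝ → G} {s : Set ℝ} (hγ : ContinuousOn γ s) :
    ContinuousOn (fun t => coadjoint μ (γ t)) s := by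
  intro t ht
  set e := chartAt E (γ t) with he
  have h1 := (locallyLipschitzOn_coadjoint μ (chart_mem_atlas E (γ t))).continuousOn.continuousAt
    (e.open_target.mem_nhds (mem_chart_target E (γ t)))
  have h2 : ContinuousWithinAt (fun τ => e (γ τ)) s t :=
    (e.continuousAt (mem_chart_source E (γ t))).comp_continuousWithinAt (hγ t ht)
  refine (ContinuousAt.comp_continuousWithinAt (f := fun τ => e (γ τ)) (x := t) h1 h2).congr_of_eventuallyEq ?_ ?_
  · filter_upwards [hγ t ht (e.open_source.mem_nhds (mem_chart_source E (γ t)))] with τ hτ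
    simp [← he, e.left_inv hτ]
  · simp [← he, e.left_inv (mem_chart_source E (γ t))]

theorem IsNormalSolution.hasDerivWithinAt {μ : E →L[ℝ] ℝ} {γ : ℝ → G} {s : Set ℝ}
    (h : IsNormalSolution P μ γ s) {e : OpenPartialHomeomorph G E} (he : e ∈ atlas E G)
    {t : ℝ} (ht : t ∈ s) (hte : γ t ∈ e.source) :
    HasDerivWithinAt (fun τ => e (γ τ)) (normalField P μ e (e (γ t))) s t := by
  have := (h t ht).hasDerivWithinAt he hte
  rwa [normalField, e.left_inv hte]

omit [ChartedSpace E G] [Group G] [LieGroup 𝓘(ℝ, E) ∞ G] in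
-- Localizes to a single chart. The interval is nondegenerate, so derivatives within it are unique,
-- and it is a relative neighbourhood, so they pass back to `[a, b]`.
theorem ContinuousOn.exists_Icc_mapsTo {γ : ℝ → G} {a b t : ℝ} (hab : a < b)
    (hγ : ContinuousOn γ (Icc a b)) (ht : t ∈ Icc a b) {U : Set G} (hU : U ∈ 𝓝 (γ t)) :
    ∃ c d, c < d ∧ Icc c d ⊆ Icc a b ∧ t ∈ Icc c d ∧ Icc c d ∈ 𝓝[Icc a b] t ∧
      MapsTo γ (Icc c d) U := by
  obtain ⟨δ, hδ, h⟩ := Metric.mem_nhdsWithin_iff.1 (hγ t ht hU)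
  have hsub : Icc (max a (t - δ / 2)) (min b (t + δ / 2)) = Icc a b ∩ Icc (t - δ / 2) (t + δ / 2) :=
    Icc_inter_Icc.symm
  refine ⟨max a (t - δ / 2), min b (t + δ / 2), ?_, ?_, ?_, ?_, ?_⟩
  · have := ht.1; have := ht.2
    rcases ht.1.eq_or_lt with h1 | h1 <;> rw [max_lt_iff, lt_min_iff, lt_min_iff] <;>
      refine ⟨⟨?_, ?_⟩, ?_, ?_⟩ <;> linarith
  · rw [hsub]; exact inter_subset_left
  · rw [hsub]; exact ⟨ht, by constructor <;> linarith⟩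
  · rw [hsub]
    exact inter_mem self_mem_nhdsWithin
      (mem_nhdsWithin_of_mem_nhds (Icc_mem_nhds (by linarith) (by linarith)))
  · rw [hsub]
    refine fun τ hτ => h ⟨?_, hτ.1⟩
    rw [Metric.mem_ball, Real.dist_eq, abs_lt]
    constructor <;> linarith [hτ.2.1, hτ.2.2]

/-- Continuous induction: the agreement set is closed because `G` is Hausdorff, and Lipschitz
uniqueness in a chart extends it to the right of each of its points. -/
theorem IsNormalSolution.eqOn [T2Space G] {K : ℝ≥0} (hP : LipschitzWith K P) {μ : E →L[ℝ] ℝ}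
    {γ γ' : ℝ → G} {a b : ℝ} (h : IsNormalSolution P μ γ (Icc a b))
    (h' : IsNormalSolution P μ γ' (Icc a b)) (ha : γ a = γ' a) : EqOn γ γ' (Icc a b) := by
  refine IsClosed.Icc_subset_of_forall_mem_nhdsWithin (s := {t | γ t = γ' t}) ?_ ha ?_
  · have : {t | γ t = γ' t} ∩ Icc a b = {t ∈ Icc a b | γ t = γ' t} := by
      ext; simp [and_comm]
    rw [this]
    exact isClosed_Icc.isClosed_eq h.continuousOn h'.continuousOn
  rintro t ⟨heq, ht⟩
  set e := chartAt E (γ t) with he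
  have hea : e ∈ atlas E G := chart_mem_atlas E (γ t)
  have hsrc : γ t ∈ e.source := mem_chart_source E (γ t)
  obtain ⟨L, U, hU, hL⟩ := locallyLipschitzOn_normalField hP μ hea (e.map_source hsrc)
  rw [nhdsWithin_eq_nhds.2 (e.open_target.mem_nhds (e.map_source hsrc))] at hU
  have hW : e.source ∩ e ⁻¹' U ∈ 𝓝 (γ t) :=
    inter_mem (e.open_source.mem_nhds hsrc) ((e.continuousAt hsrc) hU)
  have htc : t ∈ Icc a b := Ico_subset_Icc_self ht
  have hmem : ∀ᶠ τ in 𝓝[≥] t, τ ∈ Icc a b ∧ γ τ ∈ e.source ∩ e ⁻¹' U ∧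
      γ' τ ∈ e.source ∩ e ⁻¹' U := by
    have hle : 𝓝[≥] t ≤ 𝓝[Icc a b] t :=
      nhdsWithin_le_of_mem (Icc_mem_nhdsGE_of_mem ht)
    have heq' : γ' t = γ t := heq.symm
    exact hle (inter_mem self_mem_nhdsWithin
      (inter_mem (h.continuousOn t htc hW) (h'.continuousOn t htc (by rwa [heq']))))
  obtain ⟨d, hd, hsub⟩ := mem_nhdsGE_iff_exists_Icc_subset.1 hmem
  have hIab : Icc t d ⊆ Icc a b := fun τ hτ => (hsub hτ).1
  have hode : ∀ σ : ℝ → G, IsNormalSolution P μ σ (Icc a b) →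
      (∀ τ ∈ Icc t d, σ τ ∈ e.source ∩ e ⁻¹' U) →
      ContinuousOn (fun τ => e (σ τ)) (Icc t d) ∧ ∀ τ ∈ Ico t d,
        HasDerivWithinAt (fun τ => e (σ τ)) (normalField P μ e (e (σ τ))) (Ici τ) τ := by
    intro σ hσ hσU
    have hder : ∀ τ ∈ Icc t d,
        HasDerivWithinAt (fun τ => e (σ τ)) (normalField P μ e (e (σ τ))) (Icc t d) τ :=
      fun τ hτ => (hσ.hasDerivWithinAt hea (hIab hτ) (hσU τ hτ).1).mono hIab
    exact ⟨fun τ hτ => (hder τ hτ).continuousWithinAt, fun τ hτ =>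
      (hder τ (Ico_subset_Icc_self hτ)).mono_of_mem_nhdsWithin (Icc_mem_nhdsGE_of_mem hτ)⟩
  obtain ⟨hc, hd1⟩ := hode γ h fun τ hτ => (hsub hτ).2.1
  obtain ⟨hc', hd1'⟩ := hode γ' h' fun τ hτ => (hsub hτ).2.2
  have hunique := ODE_solution_unique_of_mem_Icc_right (v := fun _ => normalField P μ e)
    (s := fun _ => U) (fun _ _ => hL) hc hd1
    (fun τ hτ => (hsub (Ico_subset_Icc_self hτ)).2.1.2) hc' hd1'
    (fun τ hτ => (hsub (Ico_subset_Icc_self hτ)).2.2.2) (by simpa using congrArg e heq)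
  refine mem_of_superset (Ioc_mem_nhdsGT hd) fun τ hτ => ?_
  have hτ' := Ioc_subset_Icc_self hτ
  exact e.injOn (hsub hτ').2.1.1 (hsub hτ').2.2.1 (hunique hτ')

/-- A horizontal curve whose control is almost everywhere the normal one solves the normal equation
everywhere. -/
theorem IsACCurve.isNormalSolution [CompleteSpace E] {K : ℝ≥0} (hP : LipschitzWith K P)
    {μ : E →L[ℝ] ℝ} {γ : ℝ → G} {a b : ℝ} (hab : a < b) (hγ : IsACCurve E γ a b)
    (h : ∀ᵐ t ∂(volume.restrict (Icc a b)),
      HasLeftVelocity γ (Icc a b) t (P (coadjoint μ (γ t)))) :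
    IsNormalSolution P μ γ (Icc a b) := by
  intro t ht
  set e := chartAt E (γ t) with he
  have hea : e ∈ atlas E G := chart_mem_atlas E (γ t)
  have hsrc : γ t ∈ e.source := mem_chart_source E (γ t)
  obtain ⟨c, d, hcd, hsub, htcd, hnhds, hmaps⟩ :=
    hγ.1.exists_Icc_mapsTo hab ht (e.open_source.mem_nhds hsrc)
  have hcont : ContinuousOn (fun τ => normalField P μ e (e (γ τ))) (Icc c d) :=
    (locallyLipschitzOn_normalField hP μ hea).continuousOn.comp
      (e.continuousOn.comp (hγ.1.mono hsub) hmaps) fun τ hτ => e.map_source (hmaps hτ)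
  have hder := (hγ.2 e hea c d hcd.le hsub hmaps).hasDerivWithinAt_of_ae hcd.le hcont (by
    filter_upwards [ae_restrict_of_ae_restrict_of_subset hsub h,
      ae_restrict_mem measurableSet_Icc] with τ hτ hτm
    have := (hτ.hasDerivWithinAt hea (hmaps hτm)).mono hsub
    rwa [normalField, e.left_inv (hmaps hτm)]) t htcd
  have hder' : HasDerivWithinAt (fun τ => e (γ τ))
      (chartMulDeriv e (e.symm (e (γ t))) (P (coadjoint μ (γ t)))) (Icc c d) t := by
    rw [normalField] at hder
    rwa [e.left_inv hsrc] at hder ⊢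
  have h1 := hasLeftVelocity_symm hea (e.map_source hsrc) hder'
  have h2 : HasLeftVelocity γ (Icc c d) t (P (coadjoint μ (γ t))) :=
    h1.congr_mono (fun τ hτ => (e.left_inv (hmaps hτ)).symm) (e.left_inv hsrc).symm Subset.rfl
  exact HasMFDerivWithinAt.mono_of_mem_nhdsWithin h2 hnhds

theorem IsNormalSolution.hasDerivWithinAt_Icc {μ : E →L[ℝ] ℝ} {γ : ℝ → G} {a b : ℝ}
    (h : IsNormalSolution P μ γ (Icc a b)) {e : OpenPartialHomeomorph G E} (he : e ∈ atlas E G)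
    {c d : ℝ} (hsub : Icc c d ⊆ Icc a b) (hmaps : MapsTo γ (Icc c d) e.source) :
    ∀ t ∈ Icc c d, HasDerivWithinAt (fun τ => e (γ τ)) (normalField P μ e (e (γ t))) (Icc c d) t :=
  fun _ ht => (h.hasDerivWithinAt he (hsub ht) (hmaps ht)).mono hsub

theorem IsNormalSolution.contDiffOn {K : ℝ≥0} (hP : LipschitzWith K P) {μ : E →L[ℝ] ℝ}
    {γ : ℝ → G} {a b : ℝ} (h : IsNormalSolution P μ γ (Icc a b)) {e : OpenPartialHomeomorph G E}
    (he : e ∈ atlas E G) {c d : ℝ} (hcd : c < d) (hsub : Icc c d ⊆ Icc a b)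
    (hmaps : MapsTo γ (Icc c d) e.source) : ContDiffOn ℝ 1 (fun τ => e (γ τ)) (Icc c d) := by
  have hder := h.hasDerivWithinAt_Icc he hsub hmaps
  have hu := uniqueDiffOn_Icc hcd
  rw [show (1 : ℕ∞ω) = 0 + 1 by simp, contDiffOn_succ_iff_derivWithin hu]
  refine ⟨fun t ht => (hder t ht).differentiableWithinAt, by simp, ?_⟩
  rw [contDiffOn_zero]
  refine ContinuousOn.congr ?_ fun t ht => (hder t ht).derivWithin (hu t ht)
  exact (locallyLipschitzOn_normalField hP μ he).continuousOn.comp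
    (fun t ht => (hder t ht).continuousWithinAt) fun t ht => e.map_source (hmaps ht)

/-- In a chart the derivative is the normal field along the curve: a locally Lipschitz field on a
compact image, composed with a `C^1`, hence Lipschitz, curve. -/
theorem IsNormalSolution.isC11Curve {K : ℝ≥0} (hP : LipschitzWith K P) {μ : E →L[ℝ] ℝ}
    {γ : ℝ → G} {a b : ℝ} (hab : a < b) (h : IsNormalSolution P μ γ (Icc a b)) :
    IsC11Curve E γ a b := by
  constructor
  · intro t ht
    set e := chartAt E (γ t) with he
    have hea : e ∈ atlas E G := chart_mem_atlas E (γ t)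
    have hsrc : γ t ∈ e.source := mem_chart_source E (γ t)
    obtain ⟨c, d, hcd, hsub, htcd, hnhds, hmaps⟩ :=
      h.continuousOn.exists_Icc_mapsTo hab ht (e.open_source.mem_nhds hsrc)
    have h1 : ContMDiffWithinAt 𝓘(ℝ, ℝ) 𝓘(ℝ, E) 1 (fun τ => e (γ τ)) (Icc c d) t :=
      ((h.contDiffOn hP hea hcd hsub hmaps) t htcd).contMDiffWithinAt
    have h2 : ContMDiffWithinAt 𝓘(ℝ, ℝ) 𝓘(ℝ, E) 1 (fun τ => e.symm (e (γ τ))) (Icc c d) t :=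
      ((contMDiffAt_symm_of_mem_atlas hea (e.map_source hsrc)).of_le
        (by simp)).comp_contMDiffWithinAt t h1
    exact (h2.congr (fun τ hτ => (e.left_inv (hmaps hτ)).symm)
      (e.left_inv hsrc).symm).mono_of_mem_nhdsWithin hnhds
  · intro e he c d hcd hsub hmaps
    rcases hcd.eq_or_lt with rfl | hcd
    · exact ⟨0, by simp⟩
    have hder := h.hasDerivWithinAt_Icc he hsub hmaps
    have hu := uniqueDiffOn_Icc hcd
    obtain ⟨K₁, hK₁⟩ := (h.contDiffOn hP he hcd hsub hmaps).exists_lipschitzOnWith (by simp)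
      (convex_Icc c d) isCompact_Icc
    have hsubt : (fun τ => e (γ τ)) '' Icc c d ⊆ e.target := by
      rintro _ ⟨τ, hτ, rfl⟩
      exact e.map_source (hmaps hτ)
    obtain ⟨K₂, hK₂⟩ := ((locallyLipschitzOn_normalField hP μ he).mono
      hsubt).exists_lipschitzOnWith_of_compact (isCompact_Icc.image_of_continuousOn
        fun t ht => (hder t ht).continuousWithinAt)
    refine ⟨K₂ * K₁, ?_⟩
    have h3 := hK₂.comp hK₁ (mapsTo_image _ _)
    intro s hs t ht
    rw [(hder s hs).derivWithin (hu s hs), (hder t ht).derivWithin (hu t ht)]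
    exact h3 hs ht

theorem IsNormalSolution.isACCurve {K : ℝ≥0} (hP : LipschitzWith K P) {μ : E →L[ℝ] ℝ}
    {γ : ℝ → G} {a b : ℝ} (h : IsNormalSolution P μ γ (Icc a b)) : IsACCurve E γ a b := by
  refine ⟨h.continuousOn, fun e he c d hcd hsub hmaps => ?_⟩
  rcases hcd.eq_or_lt with rfl | hcd
  · exact LipschitzOnWith.absolutelyContinuousOnInterval (K := 0) (by simp)
  refine ContDiffOn.absolutelyContinuousOnInterval ?_
  rw [uIcc_of_le hcd.le]
  exact h.contDiffOn hP he hcd hsub hmaps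

/-- Conservation of the dual energy along curves whose velocity is parallel to the normal one. -/
theorem IsEnergyGradient.apply_coadjoint_eq (hP : IsEnergyGradient P H) {μ : E →L[ℝ] ℝ} {γ : ℝ → G}
    {a b : ℝ} {θ : ℝ → ℝ}
    (h : ∀ t ∈ Icc a b, HasLeftVelocity γ (Icc a b) t (θ t • P (coadjoint μ (γ t)))) :
    ∀ t ∈ Icc a b, H (coadjoint μ (γ t)) = H (coadjoint μ (γ a)) := by
  have hder : ∀ t ∈ Icc a b,
      HasDerivWithinAt (fun τ => H (coadjoint μ (γ τ))) 0 (Icc a b) t := by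
    intro t ht
    obtain ⟨D, hD, h0⟩ := (h t ht).exists_hasDerivWithinAt_modelAd
    have h1 := (hasDerivWithinAt_const t (Icc a b) μ).clm_comp hD
    exact hP.hasDerivWithinAt_zero (η := fun τ => coadjoint μ (γ τ)) h1 (by simp [h0])
  refine constant_of_derivWithin_zero (fun t ht => (hder t ht).differentiableWithinAt) ?_
  intro t ht
  exact (hder t (Ico_subset_Icc_self ht)).derivWithin
    (uniqueDiffOn_Icc (ht.1.trans_lt ht.2) t (Ico_subset_Icc_self ht))

theorem IsNormalSolution.apply_coadjoint_eq (hP : IsEnergyGradient P H) {μ : E →L[ℝ] ℝ}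
    {γ : ℝ → G} {a b : ℝ} (h : IsNormalSolution P μ γ (Icc a b)) :
    ∀ t ∈ Icc a b, H (coadjoint μ (γ t)) = H (coadjoint μ (γ a)) :=
  hP.apply_coadjoint_eq (θ := fun _ => 1) fun t ht => by simpa using h t ht

variable (G) in
/-- Normal curves issued from `1` exist for a time that depends only on the dual energy of the
covector: truncate the control, which bounds the speed, and use that the truncated equation also
conserves the dual energy. -/
theorem IsEnergyGradient.exists_isNormalSolution_of_le [FiniteDimensional ℝ E]
    (hP : IsEnergyGradient P H) (M : ℝ) :
    ∃ ε : ℝ, 0 < ε ∧ ∀ μ : E →L[ℝ] ℝ, H μ ≤ M →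
      ∃ σ : ℝ → G, σ 0 = 1 ∧ IsNormalSolution P μ σ (Icc 0 ε) := by
  have := FiniteDimensional.complete ℝ E
  obtain ⟨K, hK⟩ := hP.lipschitz
  obtain ⟨c, hc, hcH⟩ := hP.bound
  set φ := chartAt E (1 : G) with hφ
  have hφa : φ ∈ atlas E G := chart_mem_atlas E 1
  have hφt : φ 1 ∈ φ.target := mem_chart_target E 1
  have hA := (contDiffOn_chartMulDeriv hφa).locallyLipschitzOn_of_isOpen φ.open_target
  obtain ⟨a, ha, hball⟩ := Metric.nhds_basis_closedBall.mem_iff.1 (φ.open_target.mem_nhds hφt)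
  obtain ⟨N, hN⟩ := (isCompact_closedBall (φ 1) a).exists_bound_of_continuousOn
    (hA.continuousOn.mono hball)
  -- Chosen so that `c * M ≤ R ^ 2`: dual energy at most `M` forces `‖P‖ ≤ R`.
  set R : ℝ := |c * M| + 1 with hR
  have hRpos : 0 < R := by positivity
  -- A speed bound for the truncated field on the ball, the same for every `μ`. The Lipschitz
  -- constant `K'` below does depend on `μ`, but does not enter the existence time `a / L`.
  set L : ℝ := (|N| + 1) * R with hL
  have hLpos : 0 < L := by positivity
  refine ⟨a / L, by positivity, fun μ hμ => ?_⟩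
  set X : E → E := fun x => chartMulDeriv φ (φ.symm x)
    (radialFactor R (P (coadjoint μ (φ.symm x))) • P (coadjoint μ (φ.symm x))) with hX
  have hXlip : LocallyLipschitzOn φ.target X := hA.clm_apply
    ((lipschitzWith_radialFactor_smul hRpos).comp_locallyLipschitzOn
      (hK.comp_locallyLipschitzOn (locallyLipschitzOn_coadjoint μ hφa)))
  obtain ⟨K', hK'⟩ := (hXlip.mono hball).exists_lipschitzOnWith_of_compact
    (isCompact_closedBall (φ 1) a)
  have hXnorm : ∀ x ∈ closedBall (φ 1) a, ‖X x‖ ≤ L := by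
    intro x hx
    refine (ContinuousLinearMap.le_opNorm _ _).trans ?_
    have h1 := (hN x hx).trans ((le_abs_self N).trans (le_add_of_nonneg_right zero_le_one))
    exact mul_le_mul h1 (norm_radialFactor_smul_le hRpos _) (norm_nonneg _) (by positivity)
  have h0 : (0 : ℝ) ∈ Icc 0 (a / L) := ⟨le_rfl, by positivity⟩
  have hpl : IsPicardLindelof (fun _ => X) (⟨0, h0⟩ : Icc 0 (a / L)) (φ 1) ⟨a, ha.le⟩ 0
      ⟨L, hLpos.le⟩ K' := by
    refine ⟨fun _ _ => hK', fun _ _ => continuousOn_const, fun _ _ x hx => hXnorm x hx, ?_⟩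
    simp only [sub_zero, sub_self, NNReal.coe_zero]
    rw [max_eq_left (by positivity)]
    exact (mul_div_cancel₀ a hLpos.ne').le
  obtain ⟨x, hx0, hxb, hxd⟩ := hpl.exists_forall_mem_closedBall
  have hxt : ∀ t, x t ∈ φ.target := fun t => hball (hxb t)
  have hvel : ∀ t ∈ Icc 0 (a / L), HasLeftVelocity (fun t => φ.symm (x t)) (Icc 0 (a / L)) t
      (radialFactor R (P (coadjoint μ (φ.symm (x t)))) • P (coadjoint μ (φ.symm (x t)))) :=
    fun t ht => hasLeftVelocity_symm hφa (hxt t) (hxd t ht)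
  have hx1 : φ.symm (x 0) = 1 := by
    rw [show x 0 = φ 1 from hx0]
    exact φ.left_inv (mem_chart_source E 1)
  refine ⟨fun t => φ.symm (x t), hx1, fun t ht => ?_⟩
  -- The truncated velocity is a multiple of the normal one, so `H` is conserved and stays at most
  -- `M`; the truncation factor is then `1`.
  have hcons := hP.apply_coadjoint_eq
    (θ := fun t => radialFactor R (P (coadjoint μ (φ.symm (x t))))) hvel t ht
  rw [hx1, coadjoint_one] at hcons
  have hbd : ‖P (coadjoint μ (φ.symm (x t)))‖ ≤ R := by
    have h1 := hcH (coadjoint μ (φ.symm (x t)))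
    rw [hcons] at h1
    have h2 : c * H μ ≤ |c * M| := (mul_le_mul_of_nonneg_left hμ hc).trans (le_abs_self _)
    refine le_of_sq_le_sq ?_ hRpos.le
    nlinarith [abs_nonneg (c * M)]
  have := hvel t ht
  rwa [radialFactor_eq_one hRpos hbd, one_smul] at this

/-- Concatenation of solutions. -/
theorem IsNormalSolution.exists_extend {μ : E →L[ℝ] ℝ} {γ σ : ℝ → G} {T ε : ℝ} (hT : 0 ≤ T)
    (hε : 0 ≤ ε) (hγ : IsNormalSolution P μ γ (Icc 0 T)) (hσ0 : σ 0 = 1)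
    (hσ : IsNormalSolution P (coadjoint μ (γ T)) σ (Icc 0 ε)) :
    ∃ γ' : ℝ → G, γ' 0 = γ 0 ∧ IsNormalSolution P μ γ' (Icc 0 (T + ε)) := by
  set γ' : ℝ → G := fun t => if t ≤ T then γ t else γ T * σ (t - T) with hγ'
  have hl : ∀ t ∈ Icc 0 T, γ' t = γ t := fun t ht => if_pos ht.2
  have hr : ∀ t ∈ Icc T (T + ε), γ' t = γ T * σ (t - T) := by
    intro t ht
    rcases ht.1.eq_or_lt with rfl | h
    · simp [hγ', hσ0]
    · exact if_neg h.not_ge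
  have hL : ∀ t ∈ Icc 0 T, HasLeftVelocity γ' (Icc 0 T) t (P (coadjoint μ (γ' t))) := by
    intro t ht
    rw [hl t ht]
    exact (hγ t ht).congr_mono hl (hl t ht) Subset.rfl
  have hR : ∀ t ∈ Icc T (T + ε),
      HasLeftVelocity γ' (Icc T (T + ε)) t (P (coadjoint μ (γ' t))) := by
    intro t ht
    have h1 := ((hσ (t - T) (by constructor <;> linarith [ht.1, ht.2])).comp_sub_const).const_mul
      (γ T)
    rw [add_zero, ← coadjoint_mul] at h1
    rw [hr t ht]
    exact h1.congr_mono hr (hr t ht) Subset.rfl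
  refine ⟨γ', if_pos hT, fun t ht => ?_⟩
  rcases lt_trichotomy t T with h | rfl | h
  · exact HasMFDerivWithinAt.mono_of_mem_nhdsWithin (hL t ⟨ht.1, h.le⟩)
      (mem_nhdsWithin.2 ⟨Iio T, isOpen_Iio, h, fun τ hτ => ⟨hτ.2.1, (le_of_lt hτ.1)⟩⟩)
  -- At the junction both one-sided velocities are given by the same field at the same point, so
  -- they glue.
  · have hU : Icc 0 (t + ε) = Icc 0 t ∪ Icc t (t + ε) :=
      (Icc_union_Icc_eq_Icc hT (by linarith)).symm
    rw [hU]
    exact HasMFDerivWithinAt.union (hL t ⟨hT, le_rfl⟩) (hR t ⟨le_rfl, by linarith⟩)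
  · exact HasMFDerivWithinAt.mono_of_mem_nhdsWithin (hR t ⟨h.le, ht.2⟩)
      (mem_nhdsWithin.2 ⟨Ioi T, isOpen_Ioi, h, fun τ hτ => ⟨(le_of_lt hτ.1), hτ.2.2⟩⟩)

/-- Normal curves exist for all times. -/
theorem IsEnergyGradient.exists_isNormalSolution [FiniteDimensional ℝ E]
    (hP : IsEnergyGradient P H) (μ : E →L[ℝ] ℝ) (p : G) (T : ℝ) :
    ∃ γ : ℝ → G, γ 0 = p ∧ IsNormalSolution P μ γ (Icc 0 T) := by
  -- The dual energy at each restart equals its initial value, so one `ε` serves for every step.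
  obtain ⟨ε, hε, hloc⟩ := hP.exists_isNormalSolution_of_le G (H (coadjoint μ p))
  have key : ∀ n : ℕ, ∃ γ : ℝ → G, γ 0 = p ∧ IsNormalSolution P μ γ (Icc 0 ((n + 1) * ε)) := by
    intro n
    induction n with
    | zero =>
      obtain ⟨σ, hσ0, hσ⟩ := hloc (coadjoint μ p) le_rfl
      refine ⟨fun t => p * σ t, by simp [hσ0], ?_⟩
      simp only [Nat.cast_zero, zero_add, one_mul]
      intro t ht
      rw [coadjoint_mul]
      exact (hσ t ht).const_mul p
    | succ n ih =>
      obtain ⟨γ, hγ0, hγ⟩ := ih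
      have hT : 0 ≤ (n + 1 : ℝ) * ε := by positivity
      have hcons := hγ.apply_coadjoint_eq hP _ ⟨hT, le_rfl⟩
      rw [hγ0] at hcons
      obtain ⟨σ, hσ0, hσ⟩ := hloc _ hcons.le
      obtain ⟨γ', hγ'0, hγ'⟩ := hγ.exists_extend hT hε.le hσ0 hσ
      refine ⟨γ', hγ'0.trans hγ0, ?_⟩
      rwa [show ((n + 1 : ℕ) + 1 : ℝ) * ε = (n + 1) * ε + ε by push_cast; ring]
  obtain ⟨n, hn⟩ := exists_nat_ge (T / ε)
  obtain ⟨γ, hγ0, hγ⟩ := key n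
  refine ⟨γ, hγ0, hγ.mono (Icc_subset_Icc_right ?_)⟩
  rw [div_le_iff₀ hε] at hn
  linarith

end NormalFlow

/-! ### Existence, uniqueness and regularity of normal curves -/

theorem mainTheorem8
    {E : Type*} [NormedAddCommGroup E] [NormedSpace ℝ E] [FiniteDimensional ℝ E]
    {G : Type*} [TopologicalSpace G] [T2Space G] [ChartedSpace E G] [Group G]
    [LieGroup 𝓘(ℝ, E) ∞ G]
    (S : SubFinslerStructure E G) (hS : S.IsStronglyConvex)
    (p : G) (lam : Module.Dual ℝ (GroupLieAlgebra 𝓘(ℝ, E) G)) :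
    ∃ γ : ℝ → G,
      (S.IsNormalCurve γ 0 1 lam ∧ γ 0 = p ∧ IsC11Curve E γ 0 1) ∧
      ∀ γ' : ℝ → G, S.IsNormalCurve γ' 0 1 lam → γ' 0 = p → EqOn γ' γ (Icc 0 1) := by
  have := FiniteDimensional.complete ℝ E
  -- The Lie algebra is definitionally the model space `E`, whose norm supplies the auxiliary norm
  -- on the polarization.
  let V : Submodule ℝ E := S.V
  let n : Seminorm ℝ V := S.nrm
  let μ : E →L[ℝ] ℝ := LinearMap.toContinuousLinearMap (lam : E →ₗ[ℝ] ℝ)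
  obtain ⟨P, H, hP, hPsub⟩ := exists_isEnergyGradient V n hS
  obtain ⟨K, hK⟩ := hP.lipschitz
  have hsub : ∀ (g : G) (u : S.V),
      S.adRestrict lam g ∈ subdifferential S.energy u ↔ u = P (coadjoint μ g) :=
    fun g u => hPsub (coadjoint μ g) u
  obtain ⟨γ, hγ0, hγ⟩ := hP.exists_isNormalSolution μ p 1
  have hcont : ContinuousOn (fun t => P (coadjoint μ (γ t))) (Icc 0 1) :=
    Topology.IsInducing.subtypeVal.continuousOn_iff.2
      (hK.continuous.comp_continuousOn (continuousOn_coadjoint μ hγ.continuousOn))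
  have hn : Continuous n := continuousOn_univ.1 (n.convexOn.continuousOn isOpen_univ)
  have hmeas : AEStronglyMeasurable (fun t => P (coadjoint μ (γ t)))
      (volume.restrict (Icc (0 : ℝ) 1)) := hcont.aestronglyMeasurable measurableSet_Icc
  have hmem : MemLp (fun t => n (P (coadjoint μ (γ t)))) 2 (volume.restrict (Icc (0 : ℝ) 1)) := by
    have hnc := hn.comp_continuousOn hcont
    obtain ⟨C, hC⟩ := isCompact_Icc.exists_bound_of_continuousOn hnc
    exact MemLp.of_bound (hnc.aestronglyMeasurable measurableSet_Icc) C
      ((ae_restrict_iff' measurableSet_Icc).2 (Eventually.of_forall hC))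
  refine ⟨γ, ⟨⟨fun t => P (coadjoint μ (γ t)), ⟨hγ.isACCurve hK, ?_⟩, ?_, ?_, ?_⟩, hγ0,
    hγ.isC11Curve hK zero_lt_one⟩, ?_⟩
  · exact (ae_restrict_iff' measurableSet_Icc).2 (Eventually.of_forall hγ)
  · exact hmeas
  · exact hmem
  · exact Eventually.of_forall fun t => (hsub _ _).2 rfl
  · rintro γ' ⟨u, ⟨hac, hvel⟩, -, -, hu⟩ hγ'0
    -- The subgradient condition identifies any competing control with the normal one almost
    -- everywhere.
    refine IsNormalSolution.eqOn hK (IsACCurve.isNormalSolution hK zero_lt_one hac ?_) hγ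
      (hγ'0.trans hγ0.symm)
    filter_upwards [hvel, hu] with t ht htu
    rw [hsub] at htu
    rw [htu] at ht
    exact ht

end
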